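/- Let $n\ge 2$ and let $a:[0,\infty)\to[0,\infty)$ be nondecreasing, smooth on $(0,\infty)$, with $a(s)>0$ for $s>0$, and such that the function $s\mapsto\left[a(s^{1/n})-a(0)\right]s^{1-1/n}$ is convex on $[0,\infty)$. For a measurable set $E\subset\mathbb{R}^n$ define its surface area with density $a$ as $$P_a(E)=\sup\left\{\int_E \operatorname{div}\varphi\,dx \;:\; \varphi\in C^1_c(\mathbb{R}^n;\mathbb{R}^n),\ |\varphi(x)|\le a(|x|)\ \text{for all } x\right\}\in[0,\infty],$$ which equals $\int_{\partial E}a(|x|)\,d\mathcal{H}^{n-1}(x)$ when $E$ has smooth boundary. Then balls about the origin (bounded by hyperspheres about the origin) are isoperimetric in $\mathbb{R}^n$ with Euclidean volume and surface-area density $a$: for every $\rho>0$ and every measurable $E\subset\mathbb{R}^n$ with $|E|=|B(0,\rho)|$, $$P_a(E)\ \ge\ P_a(B(0,\rho)).$$ Moreover, they are uniquely isoperimetric: if $a(s)>a(0)$ for all $s>\rho$ (which holds for every $\rho>0$ when $a(0)=0$, or more generally when $a(s)>a(0)$ for all $s>0$), then every measurable $E$ with $|E|=|B(0,\rho)|$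 and least $P_a$ for this volume coincides with $B(0,\rho)$ up to a set of Lebesgue measure zero. -/

import Mathlib

open MeasureTheory Set
open scoped ENNReal ContDiff

noncomputable section

/-- The divergence of a vector field on `ℝⁿ`, `∑ i, ∂φᵢ/∂xᵢ`. -/
def vecDiv {n : ℕ} (φ : EuclideanSpace ℝ (Fin n) → EuclideanSpace ℝ (Fin n))
    (x : EuclideanSpace ℝ (Fin n)) : ℝ :=
  ∑ i : Fin n, (fderiv ℝ φ x (EuclideanSpace.single i 1)) i

/-- The test fields for the surface-area density `f`: compactly supported `C¹` vector fields on
`ℝⁿ` whose length is pointwise at most `f`. -/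
def testFields {n : ℕ} (f : EuclideanSpace ℝ (Fin n) → ℝ) :
    Set (EuclideanSpace ℝ (Fin n) → EuclideanSpace ℝ (Fin n)) :=
  {φ | ContDiff ℝ 1 φ ∧ HasCompactSupport φ ∧ ∀ x, ‖φ x‖ ≤ f x}

/-- The `f`-weighted surface area (weighted De Giorgi perimeter) of the boundary of a region `E`,
where `ℝⁿ` carries the surface-area density `f ≥ 0`:
the supremum of `∫_E div φ` over the test fields `|φ| ≤ f`. For a region bounded by a smooth
(or rectifiable) hypersurface and continuous `f` this is the integral of `f` over the
(reduced) boundary with respect to `(n-1)`-dimensional area; it does not see null sets. -/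
def weightedPerimeter {n : ℕ} (f : EuclideanSpace ℝ (Fin n) → ℝ)
    (E : Set (EuclideanSpace ℝ (Fin n))) : ℝ≥0∞ :=
  ⨆ φ ∈ testFields f, ENNReal.ofReal (∫ x in E, vecDiv φ x)

/-- `E` is an isoperimetric region for Euclidean volume and surface-area density `f`: its
weighted perimeter is least among all measurable sets with the same volume. -/
def IsIsoperimetric {n : ℕ} (f : EuclideanSpace ℝ (Fin n) → ℝ)
    (E : Set (EuclideanSpace ℝ (Fin n))) : Prop :=
  MeasurableSet E ∧ ∀ F : Set (EuclideanSpace ℝ (Fin n)), MeasurableSet F →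
    volume F = volume E → weightedPerimeter f E ≤ weightedPerimeter f F

end

/-!
Write `a = a(0) + b`. A test field for the constant density `a(0)` and one for `b` add up to a test
field for `a`, so it is enough to bound the two contributions separately.

The constant part is the classical isoperimetric inequality
(`sphere_area_le_of_forall_testFields`). It comes from the Brunn–Minkowski inequality for the sum of
a set and a small ball, which is derived from the Prékopa–Leindler inequality: applied to the
superlevel sets of a function `u`, it bounds `∫ ‖Du‖` from below
(`mul_sphere_area_le_integral_norm_fderiv`), and for mollifications of the indicator function of `E`
the integral `∫ ‖Du‖` is at most the perimeter of `E`.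

For the part `b`, put `h(s) = b(s ^ (1 / n)) s ^ (1 - 1 / n)`, the convex function of the hypothesis,
and `p = h'`. The radial vector field of length `b(‖x‖)` is `C¹` and has divergence `n p(‖x‖ⁿ)`,
which is a nondecreasing function of `‖x‖` since `h` is convex. It is, after truncation of `p` and
multiplication by cutoff functions, a test field for `b`, and its flux out of `E`, the integral of
its divergence, is least for the centred ball among all sets of the same volume: a calibration.
The sum of the two lower bounds is `a(ρ)` times the area of the sphere of radius `ρ`
(`ofReal_area_le_weightedPerimeter`), and by the divergence theorem no test field for `a` has a
larger flux out of the ball (`weightedPerimeter_ball_le`).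

For uniqueness, let `E` be optimal. Then no admissible perturbation of the calibrating field has
positive flux out of `E`. As a field can be shortened by adding a small vector pointing inward, the
distributional derivative of the indicator function of `E` is nonpositive in every outward direction
wherever `b > 0` (`setIntegral_vecDiv_smul_const_nonpos`). Two generic points of this region are
joined by a curve along which the norm increases, so `E` contains, with almost every point `y`,
almost every point nearer to the origin where `b > 0` (`ae_mem_of_norm_lt`). Hence an optimal set
that reaches a point `y` beyond the ball contains the whole ball of radius `‖y‖`, up to a set where
the divergence of the calibrating field vanishes, and the flux of this field out of `E` is too
large (`ae_eq_ball_of_optimal`).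
-/

open Filter Topology

noncomputable section

/-! ### The Prékopa–Leindler and Brunn–Minkowski inequalities -/

theorem IsCompact.volume_add_le_volume {K L C : Set ℝ} (hK : IsCompact K) (hL : IsCompact L)
    (hKn : K.Nonempty) (hLn : L.Nonempty) (h : ∀ x ∈ K, ∀ y ∈ L, x + y ∈ C) :
    volume K + volume L ≤ volume C := by
  obtain ⟨k, hk, hkmax⟩ := hK.exists_isGreatest hKn
  obtain ⟨l, hl, hlmin⟩ := hL.exists_isLeast hLn
  -- the translates `K + min L` and `max K + L` lie in `C` and share only the point `max K + min L`
  have h1 : volume ((fun x => l + x) ⁻¹' ((fun x => -l + x) ⁻¹' K)) = volume K := by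
    congr 1; ext x; simp
  have hd : AEDisjoint volume ((fun x => -l + x) ⁻¹' K) ((fun x => -k + x) ⁻¹' L) := by
    refine measure_mono_null (t := {k + l}) ?_ (by simp)
    rintro x ⟨hx1, hx2⟩
    have := hkmax hx1
    have := hlmin hx2
    simp only [mem_singleton_iff]; linarith
  calc volume K + volume L
      = volume ((fun x => -l + x) ⁻¹' K) + volume ((fun x => -k + x) ⁻¹' L) := by
        rw [measure_preimage_add, measure_preimage_add]
    _ = volume ((fun x => -l + x) ⁻¹' K ∪ (fun x => -k + x) ⁻¹' L) := by
        refine (measure_union₀ ?_ hd).symm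
        exact (hL.measurableSet.preimage (by fun_prop)).nullMeasurableSet
    _ ≤ volume C := by
        apply measure_mono
        rintro x (hx | hx)
        · have := h _ hx l hl
          simpa using this
        · have := h k hk _ hx
          simpa using this

/-- The one-dimensional Brunn–Minkowski inequality. -/
theorem volume_add_le_volume_of_add_mem {A B C : Set ℝ} (hA : MeasurableSet A)
    (hB : MeasurableSet B) (hAn : A.Nonempty) (hBn : B.Nonempty)
    (h : ∀ x ∈ A, ∀ y ∈ B, x + y ∈ C) : volume A + volume B ≤ volume C := by
  obtain ⟨a, ha⟩ := hAn
  obtain ⟨b, hb⟩ := hBn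
  rw [hA.measure_eq_iSup_isCompact, hB.measure_eq_iSup_isCompact]
  simp only [iSup_and']
  refine ENNReal.biSup_add_biSup_le' (p := fun K => K ⊆ A ∧ IsCompact K)
    (q := fun K => K ⊆ B ∧ IsCompact K) ⟨∅, empty_subset _, isCompact_empty⟩
    ⟨∅, empty_subset _, isCompact_empty⟩ ?_
  rintro K ⟨hKA, hK⟩ L ⟨hLB, hL⟩
  refine le_trans (add_le_add (measure_mono (subset_insert a K)) (measure_mono (subset_insert b L)))
    ((hK.insert a).volume_add_le_volume (hL.insert b) (insert_nonempty _ _) (insert_nonempty _ _) ?_)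
  intro x hx y hy
  exact h x (insert_subset ha hKA hx) y (insert_subset hb hLB hy)

theorem ofReal_mul_volume_add_le {A B C : Set ℝ} {c : ℝ} (hc0 : 0 < c) (hc1 : c < 1)
    (hA : MeasurableSet A) (hB : MeasurableSet B) (hAn : A.Nonempty) (hBn : B.Nonempty)
    (h : ∀ x ∈ A, ∀ y ∈ B, (1 - c) * x + c * y ∈ C) :
    ENNReal.ofReal (1 - c) * volume A + ENNReal.ofReal c * volume B ≤ volume C := by
  have e (d : ℝ) (hd : 0 < d) (S : Set ℝ) :
      ENNReal.ofReal d * volume S = volume ((fun x => d * x) '' S) := by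
    have := Measure.addHaar_smul (volume : Measure ℝ) d S
    simp only [Module.finrank_self, pow_one, abs_of_pos hd] at this
    rw [← this]; rfl
  rw [e _ (by linarith), e _ hc0]
  refine volume_add_le_volume_of_add_mem ?_ ?_ (hAn.image _) (hBn.image _) ?_
  · exact (measurableEmbedding_mulLeft₀ (by linarith : (1 - c) ≠ 0)).measurableSet_image.2 hA
  · exact (measurableEmbedding_mulLeft₀ hc0.ne').measurableSet_image.2 hB
  · rintro _ ⟨x, hx, rfl⟩ _ ⟨y, hy, rfl⟩
    exact h x hx y hy

theorem ENNReal.rpow_mul_rpow_le_add {a b : ℝ≥0∞} (ha : a ≠ ⊤) (hb : b ≠ ⊤) {c : ℝ} (hc0 : 0 < c)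
    (hc1 : c < 1) :
    a ^ (1 - c) * b ^ c ≤ ENNReal.ofReal (1 - c) * a + ENNReal.ofReal c * b := by
  lift a to NNReal using ha
  lift b to NNReal using hb
  rw [← ENNReal.coe_rpow_of_nonneg _ (by linarith), ← ENNReal.coe_rpow_of_nonneg _ hc0.le]
  have := NNReal.geom_mean_le_arith_mean2_weighted (1 - c).toNNReal c.toNNReal a b (by
    rw [← Real.toNNReal_add (by linarith) hc0.le]; simp)
  rw [Real.coe_toNNReal _ (by linarith), Real.coe_toNNReal _ hc0.le] at this
  unfold ENNReal.ofReal
  exact_mod_cast this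

/-- The additive form of the one-dimensional Prékopa–Leindler inequality for functions whose
supremum is `1`. -/
theorem lintegral_add_le_of_le_levels {f g h : ℝ → ℝ} {c : ℝ} (hc0 : 0 < c) (hc1 : c < 1)
    (hf : Measurable f) (hg : Measurable g) (hh : Measurable h)
    (hf0 : 0 ≤ f) (hg0 : 0 ≤ g) (hh0 : 0 ≤ h) (hf1 : ∀ x, f x ≤ 1) (hg1 : ∀ x, g x ≤ 1)
    (hfs : ∀ t < 1, ∃ x, t < f x) (hgs : ∀ t < 1, ∃ x, t < g x)
    (H : ∀ x y t, t < f x → t < g y → t ≤ h ((1 - c) * x + c * y)) :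
    ENNReal.ofReal (1 - c) * (∫⁻ x, ENNReal.ofReal (f x)) +
      ENNReal.ofReal c * (∫⁻ x, ENNReal.ofReal (g x)) ≤ ∫⁻ x, ENNReal.ofReal (h x) := by
  rw [lintegral_eq_lintegral_meas_lt _ (.of_forall hf0) hf.aemeasurable,
    lintegral_eq_lintegral_meas_lt _ (.of_forall hg0) hg.aemeasurable,
    lintegral_eq_lintegral_meas_le _ (.of_forall hh0) hh.aemeasurable]
  have mf : Measurable fun t => volume {a | t < f a} :=
    Antitone.measurable fun s t hst => measure_mono fun x hx => lt_of_le_of_lt hst hx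
  have mg : Measurable fun t => volume {a | t < g a} :=
    Antitone.measurable fun s t hst => measure_mono fun x hx => lt_of_le_of_lt hst hx
  rw [← lintegral_const_mul _ mf, ← lintegral_const_mul _ mg, ← lintegral_add_left (by fun_prop)]
  refine lintegral_mono fun t => ?_
  rcases lt_or_ge t 1 with ht | ht
  · exact ofReal_mul_volume_add_le hc0 hc1 (measurableSet_lt measurable_const hf)
      (measurableSet_lt measurable_const hg) (hfs t ht) (hgs t ht) fun x hx y hy => H x y t hx hy
  · have e1 : {a | t < f a} = ∅ := by
      ext x; simpa using (hf1 x).trans ht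
    have e2 : {a | t < g a} = ∅ := by
      ext x; simpa using (hg1 x).trans ht
    simp [e1, e2]

/-- The one-dimensional **Prékopa–Leindler inequality** for bounded integrable functions: after
division of `f` and `g` by their suprema it follows from the additive form and the inequality of
arithmetic and geometric means. -/
theorem prekopa_leindler_real {f g h : ℝ → ℝ≥0∞} {c : ℝ} (hc0 : 0 < c) (hc1 : c < 1)
    (hf : Measurable f) (hg : Measurable g) (hh : Measurable h) {M : ℝ≥0∞} (hM : M ≠ ⊤)
    (hfM : ∀ x, f x ≤ M) (hgM : ∀ x, g x ≤ M) (hfi : ∫⁻ x, f x ≠ ⊤) (hgi : ∫⁻ x, g x ≠ ⊤)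
    (H : ∀ x y, f x ^ (1 - c) * g y ^ c ≤ h ((1 - c) * x + c * y)) :
    (∫⁻ x, f x) ^ (1 - c) * (∫⁻ x, g x) ^ c ≤ ∫⁻ x, h x := by
  set A := ⨆ x, f x with hA
  set B := ⨆ x, g x with hB
  have hc1' : 0 < 1 - c := by linarith
  have hAt : A ≠ ⊤ := ne_top_of_le_ne_top hM (iSup_le hfM)
  have hBt : B ≠ ⊤ := ne_top_of_le_ne_top hM (iSup_le hgM)
  rcases eq_or_ne A 0 with hA0 | hA0
  · have : ∀ x, f x = 0 := fun x => le_antisymm (hA0 ▸ le_iSup f x) bot_le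
    simp [this, hc1']
  rcases eq_or_ne B 0 with hB0 | hB0
  · have : ∀ x, g x = 0 := fun x => le_antisymm (hB0 ▸ le_iSup g x) bot_le
    simp [this, hc0]
  set D := A ^ (1 - c) * B ^ c with hD
  have hD0 : D ≠ 0 := mul_ne_zero (by simp [hA0, hAt]) (by simp [hB0, hBt])
  have hDt : D ≠ ⊤ := ENNReal.mul_ne_top (by simp [hA0, hAt]) (by simp [hB0, hBt])
  have normal (φ : ℝ → ℝ≥0∞) (hφ : Measurable φ) (N : ℝ≥0∞) (hN0 : N ≠ 0) (hNt : N ≠ ⊤)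
      (hφN : ∀ x, φ x ≤ N) :
      ∫⁻ x, φ x = N * ∫⁻ x, ENNReal.ofReal (φ x / N).toReal := by
    rw [← lintegral_const_mul _ (by fun_prop)]
    congr 1; ext x
    rw [ENNReal.ofReal_toReal, ENNReal.mul_div_cancel hN0 hNt]
    exact ENNReal.div_ne_top (ne_top_of_le_ne_top hNt (hφN x)) hN0
  have le_one (φ : ℝ → ℝ≥0∞) (x : ℝ) : (φ x / (⨆ x, φ x)).toReal ≤ 1 :=
    ENNReal.toReal_le_of_le_ofReal zero_le_one
      (by simpa using ENNReal.div_le_of_le_mul (by simpa using le_iSup φ x))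
  have lt_sup (φ : ℝ → ℝ≥0∞) (h0 : (⨆ x, φ x) ≠ 0) (ht : (⨆ x, φ x) ≠ ⊤) (t : ℝ) (ht1 : t < 1) :
      ∃ x, t < (φ x / (⨆ x, φ x)).toReal := by
    rcases lt_or_ge t 0 with ht0 | ht0
    · exact ⟨0, ht0.trans_le ENNReal.toReal_nonneg⟩
    have : ENNReal.ofReal t * (⨆ x, φ x) < ⨆ x, φ x := by
      calc _ < 1 * (⨆ x, φ x) := by
            rw [ENNReal.mul_lt_mul_iff_left h0 ht]; simpa using ht1
        _ = _ := one_mul _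
    obtain ⟨x, hx⟩ := lt_iSup_iff.1 this
    refine ⟨x, ?_⟩
    rw [← ENNReal.ofReal_lt_iff_lt_toReal ht0
      (ENNReal.div_ne_top (ne_top_of_le_ne_top ht (le_iSup φ x)) h0)]
    rwa [ENNReal.lt_div_iff_mul_lt (.inl h0) (.inl ht)]
  have key := lintegral_add_le_of_le_levels (f := fun x => (f x / A).toReal)
    (g := fun x => (g x / B).toReal) (h := fun x => (min (h x / D) 1).toReal) hc0 hc1
    (by fun_prop) (by fun_prop) (by fun_prop) (fun _ => ENNReal.toReal_nonneg)
    (fun _ => ENNReal.toReal_nonneg) (fun _ => ENNReal.toReal_nonneg) (le_one f) (le_one g)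
    (lt_sup f hA0 hAt) (lt_sup g hB0 hBt) (by
      intro x y t htx hty
      rcases lt_or_ge t 0 with ht0 | ht0
      · exact ht0.le.trans ENNReal.toReal_nonneg
      have ht1 : t < 1 := htx.trans_le (le_one f x)
      rw [← ENNReal.ofReal_le_iff_le_toReal (by simp)]
      rw [← ENNReal.ofReal_lt_iff_lt_toReal ht0 (ENNReal.div_ne_top
        (ne_top_of_le_ne_top hM (hfM x)) hA0), ENNReal.lt_div_iff_mul_lt (.inl hA0) (.inl hAt)] at htx
      rw [← ENNReal.ofReal_lt_iff_lt_toReal ht0 (ENNReal.div_ne_top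
        (ne_top_of_le_ne_top hM (hgM y)) hB0), ENNReal.lt_div_iff_mul_lt (.inl hB0) (.inl hBt)] at hty
      refine le_min ?_ (by simpa using ht1.le)
      rw [ENNReal.le_div_iff_mul_le (.inl hD0) (.inl hDt)]
      calc ENNReal.ofReal t * D
          = (ENNReal.ofReal t * A) ^ (1 - c) * (ENNReal.ofReal t * B) ^ c := by
            rw [ENNReal.mul_rpow_of_nonneg _ _ hc1'.le, ENNReal.mul_rpow_of_nonneg _ _ hc0.le,
              mul_mul_mul_comm, ← ENNReal.rpow_add_of_nonneg _ _ hc1'.le hc0.le]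
            simp [hD]
        _ ≤ f x ^ (1 - c) * g y ^ c := by gcongr
        _ ≤ _ := H x y)
  have eA := normal f hf A hA0 hAt (le_iSup f)
  have eB := normal g hg B hB0 hBt (le_iSup g)
  rw [eA] at hfi
  rw [eB] at hgi
  have hI : ∫⁻ x, ENNReal.ofReal (f x / A).toReal ≠ ⊤ := fun e => hfi (by rw [e, ENNReal.mul_top hA0])
  have hJ : ∫⁻ x, ENNReal.ofReal (g x / B).toReal ≠ ⊤ := fun e => hgi (by rw [e, ENNReal.mul_top hB0])
  rw [eA, eB, ENNReal.mul_rpow_of_nonneg _ _ hc1'.le, ENNReal.mul_rpow_of_nonneg _ _ hc0.le,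
    mul_mul_mul_comm]
  calc _ ≤ D * ∫⁻ x, ENNReal.ofReal (min (h x / D) 1).toReal := by
        gcongr
        exact (ENNReal.rpow_mul_rpow_le_add hI hJ hc0 hc1).trans key
    _ = ∫⁻ x, D * ENNReal.ofReal (min (h x / D) 1).toReal := by
        rw [lintegral_const_mul _ (by fun_prop)]
    _ ≤ ∫⁻ x, h x := by
        refine lintegral_mono fun x => ?_
        rw [ENNReal.ofReal_toReal (by simp)]
        calc D * min (h x / D) 1 ≤ D * (h x / D) := by gcongr; exact min_le_left _ _
          _ = h x := ENNReal.mul_div_cancel hD0 hDt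

/-- The **Prékopa–Leindler inequality** for bounded functions of bounded support. -/
theorem prekopa_leindler (n : ℕ) {f g h : (Fin n → ℝ) → ℝ≥0∞} {c : ℝ} (hc0 : 0 < c) (hc1 : c < 1)
    (hf : Measurable f) (hg : Measurable g) (hh : Measurable h) {M : ℝ≥0∞} (hM : M ≠ ⊤) {R : ℝ}
    (hfM : ∀ x, f x ≤ M) (hgM : ∀ x, g x ≤ M)
    (hfR : ∀ x, f x ≠ 0 → x ∈ Metric.closedBall 0 R)
    (hgR : ∀ x, g x ≠ 0 → x ∈ Metric.closedBall 0 R)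
    (H : ∀ x y, f x ^ (1 - c) * g y ^ c ≤ h ((1 - c) • x + c • y)) :
    (∫⁻ x, f x) ^ (1 - c) * (∫⁻ x, g x) ^ c ≤ ∫⁻ x, h x := by
  have bound (M : ℝ≥0∞) (m : ℕ) (φ : (Fin m → ℝ) → ℝ≥0∞) (hφM : ∀ x, φ x ≤ M)
      (hφR : ∀ x, φ x ≠ 0 → x ∈ Metric.closedBall 0 R) :
      ∫⁻ x, φ x ≤ M * volume (Metric.closedBall (0 : Fin m → ℝ) R) := by
    rw [← setLIntegral_const]
    rw [← lintegral_indicator Metric.isClosed_closedBall.measurableSet]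
    refine lintegral_mono fun x => ?_
    by_cases hx : φ x = 0
    · simp [hx]
    · rw [indicator_of_mem (hφR x hx)]; exact hφM x
  induction n generalizing M with
  | zero =>
    have h0 := H 0 0
    rw [Subsingleton.elim ((1 - c) • (0 : Fin 0 → ℝ) + c • (0 : Fin 0 → ℝ)) 0] at h0
    simpa only [Measure.volume_pi_eq_dirac (0 : Fin 0 → ℝ), lintegral_dirac] using h0
  | succ n ih =>
    let e := (MeasurableEquiv.piFinSuccAbove (fun _ : Fin (n + 1) => ℝ) 0).symm
    have he : MeasurePreserving e :=
      (volume_preserving_piFinSuccAbove (fun _ : Fin (n + 1) => ℝ) 0).symm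
    have he' (s : ℝ) (x : Fin n → ℝ) : e (s, x) = Fin.cons s x := by
      ext i; refine Fin.cases ?_ (fun j => ?_) i <;> simp [e]
    have fub (φ : (Fin (n + 1) → ℝ) → ℝ≥0∞) (hφ : Measurable φ) :
        ∫⁻ x, φ x = ∫⁻ s, ∫⁻ x, φ (Fin.cons s x) := by
      rw [← he.lintegral_comp hφ, Measure.volume_eq_prod,
        lintegral_prod (fun p => φ (e p)) (hφ.comp e.measurable).aemeasurable]
      simp only [he']
    have mes (φ : (Fin (n + 1) → ℝ) → ℝ≥0∞) (hφ : Measurable φ) :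
        Measurable fun p : ℝ × (Fin n → ℝ) => φ (Fin.cons p.1 p.2) := by
      have := hφ.comp e.measurable
      convert this using 2 with p
      exact (congrArg φ (he' p.1 p.2)).symm
    have mem (s : ℝ) (x : Fin n → ℝ) (hx : (Fin.cons s x : Fin (n + 1) → ℝ) ∈
        Metric.closedBall 0 R) : x ∈ Metric.closedBall 0 R ∧ s ∈ Metric.closedBall 0 R := by
      have hR : 0 ≤ R := dist_nonneg.trans hx
      simp only [mem_closedBall_zero_iff, pi_norm_le_iff_of_nonneg hR] at hx ⊢
      exact ⟨fun i => by simpa using hx i.succ, by simpa using hx 0⟩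
    have fin (φ : (Fin (n + 1) → ℝ) → ℝ≥0∞) (hφM : ∀ x, φ x ≤ M)
        (hφR : ∀ x, φ x ≠ 0 → x ∈ Metric.closedBall 0 R) (s : ℝ) :
        ∫⁻ x, φ (Fin.cons s x) ≤ M * volume (Metric.closedBall (0 : Fin n → ℝ) R) :=
      bound M n _ (fun x => hφM _) (fun x hx => (mem s x (hφR _ hx)).1)
    have hball (m : ℕ) : M * volume (Metric.closedBall (0 : Fin m → ℝ) R) ≠ ⊤ :=
      ENNReal.mul_ne_top hM measure_closedBall_lt_top.ne
    rw [fub f hf, fub g hg, fub h hh]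
    refine prekopa_leindler_real hc0 hc1 ?_ ?_ ?_ (hball n) (fin f hfM hfR) (fin g hgM hgR) ?_ ?_ ?_
    · exact (mes f hf).lintegral_prod_right'
    · exact (mes g hg).lintegral_prod_right'
    · exact (mes h hh).lintegral_prod_right'
    · rw [← fub f hf]; exact ne_top_of_le_ne_top (hball _) (bound M _ f hfM hfR)
    · rw [← fub g hg]; exact ne_top_of_le_ne_top (hball _) (bound M _ g hgM hgR)
    · intro s t
      refine ih (h := fun x => h (Fin.cons ((1 - c) * s + c * t) x))
        ((mes f hf).comp measurable_prodMk_left) ((mes g hg).comp measurable_prodMk_left)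
        ((mes h hh).comp measurable_prodMk_left) hM (fun x => hfM _) (fun x => hgM _)
        (fun x hx => (mem s x (hfR _ hx)).1) (fun x hx => (mem t x (hgR _ hx)).1) ?_
      intro x y
      convert H (Fin.cons s x) (Fin.cons t y) using 2
      ext i; refine Fin.cases ?_ (fun j => ?_) i <;> simp

/-- The Brunn–Minkowski inequality in its multiplicative form. -/
theorem volume_rpow_mul_volume_rpow_le {n : ℕ} {A B C : Set (EuclideanSpace ℝ (Fin n))}
    {c : ℝ} (hc0 : 0 < c) (hc1 : c < 1) (hA : MeasurableSet A) (hB : MeasurableSet B)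
    (hC : MeasurableSet C) (hAb : Bornology.IsBounded A) (hBb : Bornology.IsBounded B)
    (h : ∀ x ∈ A, ∀ y ∈ B, (1 - c) • x + c • y ∈ C) :
    volume A ^ (1 - c) * volume B ^ c ≤ volume C := by
  let e := WithLp.toLp 2 (V := Fin n → ℝ)
  have he : MeasurePreserving e := PiLp.volume_preserving_toLp (Fin n)
  have eq (S : Set (EuclideanSpace ℝ (Fin n))) (hS : MeasurableSet S) :
      volume S = ∫⁻ x, (e ⁻¹' S).indicator 1 x := by
    rw [lintegral_indicator_one (he.measurable hS), he.measure_preimage hS.nullMeasurableSet]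
  have bdd (S : Set (EuclideanSpace ℝ (Fin n))) (hS : Bornology.IsBounded S) :
      Bornology.IsBounded (e ⁻¹' S) :=
    (PiLp.antilipschitzWith_toLp 2 (fun _ : Fin n => ℝ)).isBounded_preimage hS
  obtain ⟨R, hR⟩ := ((bdd A hAb).union (bdd B hBb)).subset_closedBall 0
  have ind (S : Set (Fin n → ℝ)) (x) : S.indicator (1 : (Fin n → ℝ) → ℝ≥0∞) x ≤ 1 :=
    indicator_le_self' (by simp) x
  rw [eq A hA, eq B hB, eq C hC]
  refine prekopa_leindler n hc0 hc1 (measurable_one.indicator (he.measurable hA))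
    (measurable_one.indicator (he.measurable hB)) (measurable_one.indicator (he.measurable hC))
    (M := 1) (by simp) (R := R) (ind _) (ind _) ?_ ?_ ?_
  · intro x hx; exact hR (.inl (mem_of_indicator_ne_zero hx))
  · intro x hx; exact hR (.inr (mem_of_indicator_ne_zero hx))
  · intro x y
    by_cases hx : x ∈ e ⁻¹' A
    · by_cases hy : y ∈ e ⁻¹' B
      · have : (1 - c) • x + c • y ∈ e ⁻¹' C := h _ hx _ hy
        simp [hx, hy, this]
      · simp [hy, hc0]
    · simp [hx, sub_pos.2 hc1]

/-- The Brunn–Minkowski inequality for the sum of a set and a ball. -/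
theorem volume_mul_pow_le_of_add_ball {n : ℕ} {A C : Set (EuclideanSpace ℝ (Fin n))}
    {ε r : ℝ} (hε : 0 < ε) (hr : 0 < r) (hA : MeasurableSet A) (hC : MeasurableSet C)
    (hAb : Bornology.IsBounded A)
    (hAr : volume A = volume (Metric.ball (0 : EuclideanSpace ℝ (Fin n)) r))
    (h : ∀ x ∈ A, ∀ y, ‖y‖ < ε → x + y ∈ C) :
    volume A * ENNReal.ofReal ((1 + ε / r) ^ n) ≤ volume C := by
  have hre : 0 < r + ε := by positivity
  set c := ε / (r + ε) with hc
  have hc0 : 0 < c := by positivity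
  have hc1 : c < 1 := by rw [hc, div_lt_one hre]; linarith
  -- the weight `c` is chosen so that `A` and the ball, once divided by the weights, have equal
  -- volume
  have e1 : 1 - c = r / (r + ε) := by rw [hc]; field_simp; ring
  set d := (1 - c)⁻¹ with hd
  have hd0 : 0 < d := by have : 0 < 1 - c := by linarith
                         positivity
  have e2 : d = 1 + ε / r := by rw [hd, e1]; field_simp
  have key := volume_rpow_mul_volume_rpow_le (A := (fun x => d • x) '' A)
    (B := (fun x => d • x) '' (Metric.ball 0 r)) (C := C) hc0 hc1
    ((measurableEmbedding_const_smul₀ hd0.ne').measurableSet_image.2 hA)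
    ((measurableEmbedding_const_smul₀ hd0.ne').measurableSet_image.2 Metric.isOpen_ball.measurableSet)
    hC (hAb.smul₀ d) (Metric.isBounded_ball.smul₀ d) (by
      rintro _ ⟨x, hx, rfl⟩ _ ⟨y, hy, rfl⟩
      have : (1 - c) • d • x + c • d • y = x + (c * d) • y := by
        rw [smul_smul, smul_smul, hd, mul_inv_cancel₀ (by linarith), one_smul]
      simp only [this]
      refine h x hx _ ?_
      have hcd : c * d = ε / r := by rw [hc, hd, e1]; field_simp
      rw [norm_smul, hcd, Real.norm_of_nonneg (by positivity)]
      calc ε / r * ‖y‖ < ε / r * r := by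
            gcongr; simpa using hy
        _ = ε := by field_simp)
  have vol (S : Set (EuclideanSpace ℝ (Fin n))) : volume ((fun x => d • x) '' S) =
      volume S * ENNReal.ofReal ((1 + ε / r) ^ n) := by
    have := Measure.addHaar_smul volume d S
    rw [finrank_euclideanSpace_fin, abs_of_pos (by positivity), e2, mul_comm] at this
    rw [← this, e2]; rfl
  rw [vol, vol, ← hAr, ← ENNReal.rpow_add_of_nonneg _ _ (by linarith) hc0.le] at key
  simpa using key

/-! ### The capacity form of the isoperimetric inequality -/

theorem exists_volume_eq_volume_ball {n : ℕ} (hn : n ≠ 0) {A : Set (EuclideanSpace ℝ (Fin n))}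
    (h0 : volume A ≠ 0) (ht : volume A ≠ ⊤) :
    ∃ r : ℝ, 0 < r ∧ volume A = volume (Metric.ball (0 : EuclideanSpace ℝ (Fin n)) r) := by
  set κ := volume (Metric.ball (0 : EuclideanSpace ℝ (Fin n)) 1) with hκ
  have hκ0 : κ ≠ 0 := (Metric.measure_ball_pos _ _ one_pos).ne'
  have hκt : κ ≠ ⊤ := measure_ball_lt_top.ne
  have hq : 0 < (volume A / κ).toReal := ENNReal.toReal_pos (by simp [h0, hκt]) (ENNReal.div_ne_top ht hκ0)
  refine ⟨(volume A / κ).toReal ^ (1 / (n : ℝ)), by positivity, ?_⟩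
  rw [Measure.addHaar_ball_of_pos _ _ (by positivity), finrank_euclideanSpace_fin, ← Real.rpow_natCast,
    ← Real.rpow_mul hq.le, one_div_mul_cancel (by exact_mod_cast hn), Real.rpow_one,
    ENNReal.ofReal_toReal (ENNReal.div_ne_top ht hκ0), ENNReal.div_mul_cancel hκ0 hκt]

/-- The linearization of the Brunn–Minkowski inequality for the sum of a set and a small ball. -/
theorem volume_add_le_of_add_ball {n : ℕ} (hn : n ≠ 0) {A C : Set (EuclideanSpace ℝ (Fin n))}
    {ε r : ℝ} (hε : 0 < ε) (hr : 0 < r) (hA : MeasurableSet A) (hC : MeasurableSet C)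
    (hAb : Bornology.IsBounded A)
    (hAr : volume (Metric.ball (0 : EuclideanSpace ℝ (Fin n)) r) ≤ volume A)
    (h : ∀ x ∈ A, ∀ y, ‖y‖ < ε → x + y ∈ C) :
    volume A + ENNReal.ofReal (ε * (n * r ^ (n - 1) *
      volume.real (Metric.ball (0 : EuclideanSpace ℝ (Fin n)) 1))) ≤ volume C := by
  obtain ⟨s, hs, hAs⟩ := exists_volume_eq_volume_ball hn
    ((Metric.measure_ball_pos volume (0 : EuclideanSpace ℝ (Fin n)) hr).trans_le hAr).ne'
    hAb.measure_lt_top.ne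
  have hκ : 0 < volume.real (Metric.ball (0 : EuclideanSpace ℝ (Fin n)) 1) :=
    ENNReal.toReal_pos (Metric.measure_ball_pos _ _ one_pos).ne' measure_ball_lt_top.ne
  have vol (q : ℝ) (hq : 0 < q) : volume (Metric.ball (0 : EuclideanSpace ℝ (Fin n)) q) =
      ENNReal.ofReal (q ^ n * volume.real (Metric.ball (0 : EuclideanSpace ℝ (Fin n)) 1)) := by
    rw [Measure.addHaar_ball_of_pos _ _ hq, finrank_euclideanSpace_fin,
      ENNReal.ofReal_mul (by positivity), Measure.real, ENNReal.ofReal_toReal measure_ball_lt_top.ne]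
  have hrs : r ≤ s := by
    rw [hAs, vol r hr, vol s hs, ENNReal.ofReal_le_ofReal_iff (by positivity),
      mul_le_mul_iff_left₀ hκ] at hAr
    exact le_of_pow_le_pow_left₀ hn hs.le hAr
  refine le_trans ?_ (volume_mul_pow_le_of_add_ball hε hs hA hC hAb hAs h)
  rw [hAs, vol s hs, ← ENNReal.ofReal_mul (by positivity), ← ENNReal.ofReal_add (by positivity)
    (by positivity)]
  apply ENNReal.ofReal_le_ofReal
  have bern : 1 + n * (ε / s) ≤ (1 + ε / s) ^ n :=
    one_add_mul_le_pow (by have : 0 < ε / s := by positivity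
                           linarith) n
  have hpow : s ^ n = s ^ (n - 1) * s := by rw [← pow_succ, Nat.sub_add_cancel (by omega)]
  have hmono : r ^ (n - 1) ≤ s ^ (n - 1) := by gcongr
  generalize volume.real (Metric.ball (0 : EuclideanSpace ℝ (Fin n)) 1) = κ at *
  calc s ^ n * κ + ε * (n * r ^ (n - 1) * κ)
      ≤ s ^ n * κ + ε * (n * s ^ (n - 1) * κ) := by gcongr
    _ = s ^ n * κ * (1 + n * (ε / s)) := by rw [hpow]; field_simp
    _ ≤ _ := by gcongr

/-- If every superlevel set of `u ≥ 0` below level `t` is at least as large as the ball of radius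
`r`, and the superlevel sets of `U` contain the `ε`-neighbourhoods of those of `u`, then `∫ U`
exceeds `∫ u` by at least `ε t` times the area of the sphere of radius `r`. -/
theorem lintegral_add_le_of_levels {n : ℕ} (hn : n ≠ 0) {u U : EuclideanSpace ℝ (Fin n) → ℝ}
    (hu : Measurable u) (hU : Measurable U) (hub : HasCompactSupport u) (hu0 : 0 ≤ u) (hU0 : 0 ≤ U)
    {t r ε : ℝ} (hr : 0 < r) (hε : 0 < ε)
    (hV : volume (Metric.ball (0 : EuclideanSpace ℝ (Fin n)) r) ≤ volume {x | t < u x})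
    (h : ∀ s, 0 < s → ∀ x, s < u x → ∀ y, ‖y‖ < ε → s < U (x + y)) :
    (∫⁻ x, ENNReal.ofReal (u x)) + ENNReal.ofReal t * ENNReal.ofReal (ε * (n * r ^ (n - 1) *
      volume.real (Metric.ball (0 : EuclideanSpace ℝ (Fin n)) 1))) ≤
      ∫⁻ x, ENNReal.ofReal (U x) := by
  rw [lintegral_eq_lintegral_meas_lt _ (.of_forall hu0) hu.aemeasurable,
    lintegral_eq_lintegral_meas_lt _ (.of_forall hU0) hU.aemeasurable]
  set c := ENNReal.ofReal (ε * (n * r ^ (n - 1) *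
      volume.real (Metric.ball (0 : EuclideanSpace ℝ (Fin n)) 1)))
  have e : ENNReal.ofReal t * c = ∫⁻ s in Ioi (0 : ℝ), (Iio t).indicator (fun _ => c) s := by
    rw [lintegral_indicator measurableSet_Iio, setLIntegral_const,
      Measure.restrict_apply measurableSet_Iio, inter_comm, Ioi_inter_Iio, Real.volume_Ioo, sub_zero,
      mul_comm]
  rw [e, ← lintegral_add_right _ (measurable_const.indicator measurableSet_Iio)]
  refine setLIntegral_mono' measurableSet_Ioi fun s hs => ?_
  by_cases hst : s < t
  · simp only [mem_Iio, hst, indicator_of_mem]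
    refine volume_add_le_of_add_ball hn hε hr (measurableSet_lt measurable_const hu)
      (measurableSet_lt measurable_const hU) ?_ (hV.trans ?_) (h s hs)
    · refine hub.isCompact.isBounded.subset fun x hx => subset_tsupport _ ?_
      exact (lt_trans hs hx).ne'
    · exact measure_mono fun x hx => hst.trans hx
  · simp only [mem_Iio, hst, not_false_eq_true, indicator_of_notMem, add_zero]
    exact measure_mono fun x hx => by simpa using h s hs x hx 0 (by simpa using hε)

/-- A capacity form of the isoperimetric inequality: if `{u > t}` is at least as large as the ball
of radius `r`, then `∫ ‖Du‖` is at least `t` times the area of the sphere of radius `r`. -/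
theorem mul_sphere_area_le_integral_norm_fderiv {n : ℕ} (hn : n ≠ 0)
    {u : EuclideanSpace ℝ (Fin n) → ℝ} (hu : ContDiff ℝ 1 u) (hc : HasCompactSupport u)
    (hu0 : 0 ≤ u) {t r : ℝ} (ht : 0 < t) (hr : 0 < r)
    (hV : volume (Metric.ball (0 : EuclideanSpace ℝ (Fin n)) r) ≤ volume {x | t < u x}) :
    t * (n * r ^ (n - 1) * volume.real (Metric.ball (0 : EuclideanSpace ℝ (Fin n)) 1)) ≤
      ∫ x, ‖fderiv ℝ u x‖ := by
  set S := n * r ^ (n - 1) * volume.real (Metric.ball (0 : EuclideanSpace ℝ (Fin n)) 1)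
  have hS : 0 ≤ S := by positivity
  set K := Metric.cthickening 1 (tsupport u) with hK
  have hKc : IsCompact K := hc.isCompact.cthickening
  have hDc : Continuous (fderiv ℝ u) := hu.continuous_fderiv one_ne_zero
  have hDs : HasCompactSupport (fderiv ℝ u) := hc.fderiv (𝕜 := ℝ)
  have hDi : Integrable (fun x => ‖fderiv ℝ u x‖) := (hDc.integrable_of_hasCompactSupport hDs).norm
  have hui : Integrable u := hu.continuous.integrable_of_hasCompactSupport hc
  have unif : UniformContinuous (fderiv ℝ u) := hDs.uniformContinuous_of_continuous hDc
  -- `U = u + ε (‖Du‖ + τ)` near the support of `u` dominates the supremum of `u` over `ε`-balls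
  have main (τ : ℝ) (hτ : 0 < τ) : t * S ≤ (∫ x, ‖fderiv ℝ u x‖) + τ * volume.real K := by
    obtain ⟨ε', hε', hmod⟩ := Metric.uniformContinuous_iff.1 unif τ hτ
    set ε := min ε' 1
    have hε : 0 < ε := lt_min hε' one_pos
    let U : EuclideanSpace ℝ (Fin n) → ℝ := fun x =>
      u x + ε * (‖fderiv ℝ u x‖ + τ * K.indicator 1 x)
    have hKi : Integrable (K.indicator (1 : EuclideanSpace ℝ (Fin n) → ℝ)) :=
      (integrable_indicator_iff hKc.measurableSet).2 (integrableOn_const hKc.measure_lt_top.ne)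
    have hU0 : 0 ≤ U := fun x => by
      have h1 : 0 ≤ u x := hu0 x
      have h2 : 0 ≤ K.indicator (1 : EuclideanSpace ℝ (Fin n) → ℝ) x :=
        indicator_nonneg (fun _ _ => zero_le_one) x
      simp only [Pi.zero_apply, U]; positivity
    have hUm : Measurable U := by
      have := measurable_one (α := ℝ) (β := EuclideanSpace ℝ (Fin n)) |>.indicator hKc.measurableSet
      have := hu.continuous.measurable
      have := hDc.norm.measurable
      fun_prop
    have hWi : Integrable (fun x => ‖fderiv ℝ u x‖ + τ * K.indicator 1 x) :=
      hDi.add (hKi.const_mul τ)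
    have hUi : Integrable U := hui.add (hWi.const_mul ε)
    have step := lintegral_add_le_of_levels hn hu.continuous.measurable hUm hc hu0 hU0 hr hε hV (by
      intro s hs x hx y hy
      refine hx.trans_le ?_
      have hxs : x ∈ tsupport u := subset_tsupport _ (hs.trans hx).ne'
      have hmem : x + y ∈ K := by
        refine Metric.mem_cthickening_of_dist_le (x + y) x 1 _ hxs ?_
        simpa using hy.le.trans (min_le_right _ _)
      have mv := (convex_ball (x + y) ε).norm_image_sub_le_of_norm_fderiv_le (𝕜 := ℝ) (f := u)
        (C := ‖fderiv ℝ u (x + y)‖ + τ) (x := x + y) (y := x)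
        (fun z _ => (hu.differentiable one_ne_zero) z) (fun z hz => by
          have : dist (fderiv ℝ u z) (fderiv ℝ u (x + y)) < τ :=
            hmod ((Metric.mem_ball.1 hz).trans_le (min_le_left _ _))
          rw [dist_eq_norm] at this
          calc ‖fderiv ℝ u z‖ = ‖fderiv ℝ u (x + y) + (fderiv ℝ u z - fderiv ℝ u (x + y))‖ := by
                congr 1; abel
            _ ≤ _ := norm_add_le _ _
            _ ≤ _ := by gcongr) (Metric.mem_ball_self hε) (by simpa using hy)
      have hle : ‖x - (x + y)‖ ≤ ε := by simpa using hy.le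
      have mv2 := (le_abs_self _).trans (mv.trans (mul_le_mul_of_nonneg_left hle (by positivity)))
      simp only [U, indicator_of_mem hmem, Pi.one_apply, mul_one]
      linarith)
    rw [← ofReal_integral_eq_lintegral_ofReal hui (.of_forall hu0),
      ← ofReal_integral_eq_lintegral_ofReal hUi (.of_forall hU0),
      ← ENNReal.ofReal_mul ht.le, ← ENNReal.ofReal_add (integral_nonneg hu0) (by positivity),
      ENNReal.ofReal_le_ofReal_iff (integral_nonneg hU0)] at step
    have eU : ∫ x, U x = (∫ x, u x) + ε * ((∫ x, ‖fderiv ℝ u x‖) + τ * volume.real K) := by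
      rw [integral_add hui (hWi.const_mul ε), integral_const_mul,
        integral_add hDi (hKi.const_mul τ), integral_const_mul, integral_indicator_one hKc.measurableSet]
    rw [eU] at step
    have : ε * (t * S) ≤ ε * ((∫ x, ‖fderiv ℝ u x‖) + τ * volume.real K) := by linarith
    exact le_of_mul_le_mul_left this hε
  refine le_of_forall_pos_le_add fun δ hδ => ?_
  have hK0 : 0 ≤ volume.real K := measureReal_nonneg
  refine (main (δ / (volume.real K + 1)) (by positivity)).trans ?_
  gcongr
  rw [div_mul_eq_mul_div, div_le_iff₀ (by positivity)]
  nlinarith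

/-! ### Divergence and cutoff functions -/

theorem sum_clm_single_mul {n : ℕ} (l : EuclideanSpace ℝ (Fin n) →L[ℝ] ℝ)
    (v : EuclideanSpace ℝ (Fin n)) : ∑ i, l (EuclideanSpace.single i 1) * v i = l v := by
  conv_rhs => rw [← (EuclideanSpace.basisFun (Fin n) ℝ).sum_repr v]
  simp [map_sum, mul_comm]

theorem vecDiv_smul {n : ℕ} {g : EuclideanSpace ℝ (Fin n) → ℝ}
    {φ : EuclideanSpace ℝ (Fin n) → EuclideanSpace ℝ (Fin n)} {x : EuclideanSpace ℝ (Fin n)}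
    (hg : DifferentiableAt ℝ g x) (hφ : DifferentiableAt ℝ φ x) :
    vecDiv (fun y => g y • φ y) x = g x * vecDiv φ x + fderiv ℝ g x (φ x) := by
  simp only [vecDiv, fderiv_fun_smul hg hφ]
  simp only [add_apply, smul_apply,
    ContinuousLinearMap.smulRight_apply, PiLp.add_apply, PiLp.smul_apply, smul_eq_mul,
    Finset.sum_add_distrib, ← Finset.mul_sum, sum_clm_single_mul]

theorem vecDiv_add {n : ℕ} {φ ψ : EuclideanSpace ℝ (Fin n) → EuclideanSpace ℝ (Fin n)}
    {x : EuclideanSpace ℝ (Fin n)}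
    (hφ : DifferentiableAt ℝ φ x) (hψ : DifferentiableAt ℝ ψ x) :
    vecDiv (fun y => φ y + ψ y) x = vecDiv φ x + vecDiv ψ x := by
  simp [vecDiv, fderiv_fun_add hφ hψ, Finset.sum_add_distrib]

theorem vecDiv_const_smul {n : ℕ} {φ : EuclideanSpace ℝ (Fin n) → EuclideanSpace ℝ (Fin n)} (c : ℝ)
    {x : EuclideanSpace ℝ (Fin n)} (hφ : DifferentiableAt ℝ φ x) :
    vecDiv (fun y => c • φ y) x = c * vecDiv φ x := by
  simp [vecDiv, fderiv_fun_const_smul hφ, Finset.mul_sum]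

theorem continuous_vecDiv {n : ℕ} {φ : EuclideanSpace ℝ (Fin n) → EuclideanSpace ℝ (Fin n)}
    (hφ : ContDiff ℝ 1 φ) : Continuous (vecDiv φ) := by
  have := hφ.continuous_fderiv one_ne_zero
  unfold vecDiv
  fun_prop

theorem hasCompactSupport_vecDiv {n : ℕ} {φ : EuclideanSpace ℝ (Fin n) → EuclideanSpace ℝ (Fin n)}
    (hφ : HasCompactSupport φ) : HasCompactSupport (vecDiv φ) :=
  (hφ.fderiv (𝕜 := ℝ)).mono fun x hx h => hx (by simp [vecDiv, h])

theorem integrable_vecDiv {n : ℕ} {φ : EuclideanSpace ℝ (Fin n) → EuclideanSpace ℝ (Fin n)}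
    (hφ : ContDiff ℝ 1 φ) (hc : HasCompactSupport φ) : Integrable (vecDiv φ) :=
  (continuous_vecDiv hφ).integrable_of_hasCompactSupport (hasCompactSupport_vecDiv hc)

section Cutoff

variable (n : ℕ)

/-- A smooth function equal to `1` on the unit ball and supported in the ball of radius `2`. -/
def unitBump : ContDiffBump (0 : EuclideanSpace ℝ (Fin n)) := ⟨1, 2, one_pos, one_lt_two⟩

variable {n}

/-- Smooth cutoff functions, equal to `1` on the ball of radius `k + 1` and supported in the ball
of radius `2 (k + 1)`. -/
def cutoff (k : ℕ) (x : EuclideanSpace ℝ (Fin n)) : ℝ := unitBump n (((k : ℝ) + 1)⁻¹ • x)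

theorem contDiff_cutoff (k : ℕ) {m : ℕ∞} : ContDiff ℝ m (cutoff (n := n) k) :=
  (unitBump n).contDiff.comp (contDiff_const_smul _)

theorem cutoff_nonneg (k : ℕ) (x : EuclideanSpace ℝ (Fin n)) : 0 ≤ cutoff k x :=
  (unitBump n).nonneg

theorem cutoff_le_one (k : ℕ) (x : EuclideanSpace ℝ (Fin n)) : cutoff k x ≤ 1 :=
  (unitBump n).le_one

theorem hasCompactSupport_cutoff (k : ℕ) : HasCompactSupport (cutoff (n := n) k) :=
  (unitBump n).hasCompactSupport.comp_smul (by positivity)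

theorem cutoff_eventuallyEq_one {k : ℕ} {x : EuclideanSpace ℝ (Fin n)} (hx : ‖x‖ < k + 1) :
    cutoff k =ᶠ[𝓝 x] 1 := by
  have : Tendsto (fun y : EuclideanSpace ℝ (Fin n) => ((k : ℝ) + 1)⁻¹ • y) (𝓝 x)
    (𝓝 (((k : ℝ) + 1)⁻¹ • x)) := (continuous_const_smul _).tendsto _
  refine this.eventually ((unitBump n).eventuallyEq_one_of_mem_ball ?_)
  simp only [unitBump, mem_ball_zero_iff, norm_smul, norm_inv]
  rw [Real.norm_of_nonneg (by positivity), inv_mul_lt_one₀ (by positivity)]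
  exact hx

theorem cutoff_eq_one {k : ℕ} {x : EuclideanSpace ℝ (Fin n)} (hx : ‖x‖ < k + 1) :
    cutoff k x = 1 := (cutoff_eventuallyEq_one hx).eq_of_nhds

theorem fderiv_cutoff_eq_zero {k : ℕ} {x : EuclideanSpace ℝ (Fin n)} (hx : ‖x‖ < k + 1) :
    fderiv ℝ (cutoff k) x = 0 := by
  rw [(cutoff_eventuallyEq_one hx).fderiv_eq]
  exact fderiv_const_apply _

theorem fderiv_cutoff (k : ℕ) (x : EuclideanSpace ℝ (Fin n)) :
    fderiv ℝ (cutoff k) x = ((k : ℝ) + 1)⁻¹ • fderiv ℝ (unitBump n) (((k : ℝ) + 1)⁻¹ • x) :=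
  fderiv_comp_smul (f := unitBump n) _

/-- The gradients of the cutoff functions tend to zero uniformly, and remain bounded after
multiplication by `‖x‖`, as they live at distance of order `k` from the origin. -/
theorem exists_norm_fderiv_cutoff_le (n : ℕ) : ∃ C : ℝ, 0 ≤ C ∧
    ∀ (k : ℕ) (x : EuclideanSpace ℝ (Fin n)), ‖fderiv ℝ (cutoff k) x‖ ≤ C / (k + 1) ∧
      ‖fderiv ℝ (cutoff k) x‖ * ‖x‖ ≤ C := by
  have hcont : Continuous (fderiv ℝ (unitBump n)) :=
    ((unitBump n).contDiff (n := 1)).continuous_fderiv one_ne_zero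
  have hcs := (unitBump n).hasCompactSupport.fderiv (𝕜 := ℝ)
  obtain ⟨C₁, h₁⟩ := hcs.exists_bound_of_continuous hcont
  obtain ⟨C₂, h₂⟩ := (HasCompactSupport.smul_left (f := fun x => ‖x‖) hcs).exists_bound_of_continuous
    (continuous_norm.smul hcont)
  refine ⟨max C₁ C₂, ((norm_nonneg _).trans (h₁ 0)).trans (le_max_left _ _), fun k x => ?_⟩
  have hk : (0 : ℝ) < k + 1 := by positivity
  rw [fderiv_cutoff, norm_smul, norm_inv, Real.norm_of_nonneg hk.le]
  constructor
  · rw [div_eq_inv_mul]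
    gcongr
    exact (h₁ _).trans (le_max_left _ _)
  · have := h₂ (((k : ℝ) + 1)⁻¹ • x)
    simp only [Pi.smul_apply', norm_smul, norm_inv, Real.norm_of_nonneg hk.le, norm_norm,
      norm_mul] at this
    calc _ = _ := by ring
      _ ≤ _ := this
      _ ≤ _ := le_max_right _ _

theorem tendsto_cutoff (x : EuclideanSpace ℝ (Fin n)) :
    Tendsto (fun k => cutoff k x) atTop (𝓝 1) := by
  refine tendsto_const_nhds.congr' ?_
  obtain ⟨N, hN⟩ := exists_nat_gt ‖x‖
  filter_upwards [eventually_ge_atTop N] with k hk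
  have : (N : ℝ) ≤ k := by exact_mod_cast hk
  exact (cutoff_eq_one (by linarith)).symm

end Cutoff

/-! ### Mollified indicator functions -/

section Mollify

variable {n : ℕ}

/-- The convolution of the indicator function of `E` with the kernel `η`. -/
def mollify (η : EuclideanSpace ℝ (Fin n) → ℝ) (E : Set (EuclideanSpace ℝ (Fin n)))
    (x : EuclideanSpace ℝ (Fin n)) : ℝ :=
  ∫ t in E, η (x - t)

/-- The convolution of the vector field `V` with the kernel `η`. -/
def mollifyField (η : EuclideanSpace ℝ (Fin n) → ℝ)
    (V : EuclideanSpace ℝ (Fin n) → EuclideanSpace ℝ (Fin n))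
    (x : EuclideanSpace ℝ (Fin n)) : EuclideanSpace ℝ (Fin n) :=
  ∫ t, η (x - t) • V t

variable {η : EuclideanSpace ℝ (Fin n) → ℝ} {E : Set (EuclideanSpace ℝ (Fin n))}
  {V : EuclideanSpace ℝ (Fin n) → EuclideanSpace ℝ (Fin n)}

theorem mollify_eq_convolution (hE : MeasurableSet E) :
    mollify η E = convolution (E.indicator fun _ => (1 : ℝ)) η (ContinuousLinearMap.lsmul ℝ ℝ) := by
  ext x
  rw [mollify, convolution_def, ← integral_indicator hE]
  congr 1; ext t
  by_cases ht : t ∈ E <;> simp [ht]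

theorem mollifyField_eq_convolution :
    mollifyField η V = convolution V η (ContinuousLinearMap.lsmul ℝ ℝ).flip := by
  ext1 x
  simp [mollifyField, convolution_def]

theorem locallyIntegrable_indicator_one (hE : MeasurableSet E) :
    LocallyIntegrable (E.indicator fun _ => (1 : ℝ)) volume :=
  (locallyIntegrable_const (1 : ℝ)).indicator hE

theorem contDiff_mollify (hE : MeasurableSet E) (hη : ContDiff ℝ 1 η) (hc : HasCompactSupport η) :
    ContDiff ℝ 1 (mollify η E) := by
  rw [mollify_eq_convolution hE]
  exact hc.contDiff_convolution_right (n := 1) _ (locallyIntegrable_indicator_one hE) hη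

theorem fderiv_mollify_apply (hE : MeasurableSet E) (hη : ContDiff ℝ 1 η) (hc : HasCompactSupport η)
    (x v : EuclideanSpace ℝ (Fin n)) :
    fderiv ℝ (mollify η E) x v = ∫ t in E, fderiv ℝ η (x - t) v := by
  rw [mollify_eq_convolution hE, (hc.hasFDerivAt_convolution_right _
    (locallyIntegrable_indicator_one hE) hη x).fderiv, convolution_precompR_apply _
    (locallyIntegrable_indicator_one hE) (hc.fderiv (𝕜 := ℝ)) (hη.continuous_fderiv one_ne_zero),
    convolution_def, ← integral_indicator hE]
  congr 1; ext t
  by_cases ht : t ∈ E <;> simp [ht]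

theorem contDiff_mollifyField (hη : ContDiff ℝ 1 η) (hc : HasCompactSupport η)
    (hV : Continuous V) : ContDiff ℝ 1 (mollifyField η V) := by
  rw [mollifyField_eq_convolution]
  exact hc.contDiff_convolution_right (n := 1) _ hV.locallyIntegrable hη

theorem hasCompactSupport_mollifyField (hc : HasCompactSupport η) (hVc : HasCompactSupport V) :
    HasCompactSupport (mollifyField η V) := by
  rw [mollifyField_eq_convolution]
  exact hVc.convolution _ hc

theorem vecDiv_mollifyField (hη : ContDiff ℝ 1 η) (hc : HasCompactSupport η)
    (hV : Continuous V) (x : EuclideanSpace ℝ (Fin n)) :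
    vecDiv (mollifyField η V) x = ∫ t, fderiv ℝ η (x - t) (V t) := by
  have hD := hη.continuous_fderiv one_ne_zero
  have hDc : HasCompactSupport fun t => fderiv ℝ η (x - t) :=
    (hc.fderiv (𝕜 := ℝ)).comp_homeomorph (Homeomorph.subLeft x)
  have hi (v : EuclideanSpace ℝ (Fin n)) : Integrable fun t => fderiv ℝ η (x - t) v • V t := by
    refine Continuous.integrable_of_hasCompactSupport (by fun_prop) (hDc.mono fun t ht h => ht ?_)
    simp [h]
  have h1 (v : EuclideanSpace ℝ (Fin n)) :
      fderiv ℝ (mollifyField η V) x v = ∫ t, fderiv ℝ η (x - t) v • V t := by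
    rw [mollifyField_eq_convolution, (hc.hasFDerivAt_convolution_right _
      hV.locallyIntegrable hη x).fderiv, convolution_precompR_apply _
      hV.locallyIntegrable (hc.fderiv (𝕜 := ℝ)) hD, convolution_def]
    simp
  have h2 (v : EuclideanSpace ℝ (Fin n)) (i : Fin n) : (fderiv ℝ (mollifyField η V) x v) i =
      ∫ t, fderiv ℝ η (x - t) v * V t i := by
    rw [h1]
    exact ((EuclideanSpace.proj i : EuclideanSpace ℝ (Fin n) →L[ℝ] ℝ).integral_comp_comm (hi v)).symm
  simp only [vecDiv, h2]
  rw [← integral_finsetSum]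
  · simp only [sum_clm_single_mul]
  · intro i _
    exact (EuclideanSpace.proj i : EuclideanSpace ℝ (Fin n) →L[ℝ] ℝ).integrable_comp (hi _)

/-- Convolution with an even kernel is self-adjoint: integrating the gradient of a mollified
indicator function against `V` amounts to integrating the divergence of the mollified field. -/
theorem integral_fderiv_mollify (hE : MeasurableSet E) (hη : ContDiff ℝ 1 η)
    (hc : HasCompactSupport η) (heven : ∀ x, η (-x) = η x) (hV : Continuous V)
    (hVc : HasCompactSupport V) :
    ∫ x, fderiv ℝ (mollify η E) x (V x) = - ∫ t in E, vecDiv (mollifyField η V) t := by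
  have hD := hη.continuous_fderiv one_ne_zero
  have hodd (x) : fderiv ℝ η (-x) = - fderiv ℝ η x := by
    have := fderiv_comp_smul (f := η) (x := x) (-1 : ℝ)
    simp only [neg_one_smul, heven] at this
    rw [this, neg_neg]
  have hG : Integrable (fun p : EuclideanSpace ℝ (Fin n) × EuclideanSpace ℝ (Fin n) =>
      fderiv ℝ η (p.1 - p.2) (V p.1)) (volume.prod (volume.restrict E)) := by
    have : (volume : Measure (EuclideanSpace ℝ (Fin n))).prod (volume.restrict E) =
        (volume.prod volume).restrict (univ ×ˢ E) := by
      rw [← Measure.prod_restrict, Measure.restrict_univ]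
    rw [this]
    refine Integrable.restrict (Continuous.integrable_of_hasCompactSupport (by fun_prop) ?_)
    refine HasCompactSupport.intro
      (K := tsupport V ×ˢ ((fun q : _ × _ => q.1 - q.2) '' (tsupport V ×ˢ tsupport (fderiv ℝ η))))
      (hVc.isCompact.prod ((hVc.isCompact.prod (hc.fderiv (𝕜 := ℝ)).isCompact).image
        (by fun_prop))) ?_
    rintro ⟨x, t⟩ hxt
    by_contra hne
    apply hxt
    have hx : x ∈ tsupport V := subset_tsupport _ fun h => hne (by simp [h])
    refine ⟨hx, ⟨(x, x - t), ⟨hx, subset_tsupport _ fun h => hne (by simp [h])⟩, by simp⟩⟩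
  simp only [fderiv_mollify_apply hE hη hc, vecDiv_mollifyField hη hc hV]
  rw [integral_integral_swap hG, ← integral_neg]
  congr 1; ext t
  rw [← integral_neg]
  congr 1; ext x
  rw [← neg_sub t x, hodd]; simp

theorem mollifyField_mem_testFields (hη : ContDiff ℝ 1 η)
    (hc : HasCompactSupport η) (hη0 : ∀ x, 0 ≤ η x) (hη1 : ∫ x, η x = 1) (hV : Continuous V)
    (hVc : HasCompactSupport V) (hV1 : ∀ x, ‖V x‖ ≤ 1) :
    mollifyField η V ∈ testFields fun _ => (1 : ℝ) := by
  refine ⟨contDiff_mollifyField hη hc hV, hasCompactSupport_mollifyField hc hVc, fun x => ?_⟩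
  have hi : Integrable fun t => η (x - t) :=
    ((hη.continuous.integrable_of_hasCompactSupport hc).comp_sub_left x)
  calc ‖mollifyField η V x‖ ≤ ∫ t, η (x - t) := by
        refine norm_integral_le_of_norm_le hi (.of_forall fun t => ?_)
        rw [norm_smul, Real.norm_of_nonneg (hη0 _)]
        exact mul_le_of_le_one_right (hη0 _) (hV1 t)
    _ = 1 := by rw [integral_sub_left_eq_self (fun t => η t), hη1]

theorem mollify_nonneg (hη0 : ∀ x, 0 ≤ η x) (x) : 0 ≤ mollify η E x :=
  integral_nonneg fun _ => hη0 _

theorem integrable_mollify (hE : MeasurableSet E) (hEt : volume E ≠ ⊤) (hη : ContDiff ℝ 1 η)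
    (hc : HasCompactSupport η) : Integrable (mollify η E) := by
  rw [mollify_eq_convolution hE]
  exact ((integrable_indicator_iff hE).2 (integrableOn_const hEt)).integrable_convolution _
    (hη.continuous.integrable_of_hasCompactSupport hc)

theorem integral_mollify (hE : MeasurableSet E) (hEt : volume E ≠ ⊤) (hη : ContDiff ℝ 1 η)
    (hc : HasCompactSupport η) (hη1 : ∫ x, η x = 1) : ∫ x, mollify η E x = volume.real E := by
  rw [mollify_eq_convolution hE, integral_convolution _
    ((integrable_indicator_iff hE).2 (integrableOn_const hEt))
    (hη.continuous.integrable_of_hasCompactSupport hc), hη1]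
  simp [integral_indicator_const (1 : ℝ) hE]

/-- The perimeter of `E` bounds the total variation of the mollified indicator function. -/
theorem integral_mul_norm_fderiv_mollify_le (hE : MeasurableSet E) (hη : ContDiff ℝ 1 η)
    (hc : HasCompactSupport η) (heven : ∀ x, η (-x) = η x) (hη0 : ∀ x, 0 ≤ η x)
    (hη1 : ∫ x, η x = 1) {P : ℝ}
    (hP : ∀ φ ∈ testFields (n := n) fun _ => (1 : ℝ), ∫ x in E, vecDiv φ x ≤ P)
    {χ : EuclideanSpace ℝ (Fin n) → ℝ} (hχ : Continuous χ) (hχc : HasCompactSupport χ)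
    (hχ0 : ∀ x, 0 ≤ χ x) (hχ1 : ∀ x, χ x ≤ 1) :
    ∫ x, χ x * ‖fderiv ℝ (mollify η E) x‖ ≤ P := by
  set f := mollify η E with hf
  have hfc : Continuous (fderiv ℝ f) := (contDiff_mollify hE hη hc).continuous_fderiv one_ne_zero
  let G : EuclideanSpace ℝ (Fin n) → EuclideanSpace ℝ (Fin n) := fun x =>
    (InnerProductSpace.toDual ℝ (EuclideanSpace ℝ (Fin n))).symm (fderiv ℝ f x)
  have hGc : Continuous G := (LinearIsometryEquiv.continuous _).comp hfc
  have hGn (x) : ‖G x‖ = ‖fderiv ℝ f x‖ := LinearIsometryEquiv.norm_map _ _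
  have hGa (x) : fderiv ℝ f x (G x) = ‖fderiv ℝ f x‖ ^ 2 := by
    have : inner ℝ (G x) (G x) = fderiv ℝ f x (G x) := InnerProductSpace.toDual_symm_apply
    rw [← this, real_inner_self_eq_norm_sq, hGn]
  have hχi : Integrable χ := hχ.integrable_of_hasCompactSupport hχc
  -- the field `-χ ∇f / (|∇f| + τ)` is a continuous approximation of the unit normal field
  have main (τ : ℝ) (hτ : 0 < τ) : ∫ x, χ x * ‖fderiv ℝ f x‖ ≤ P + τ * ∫ x, χ x := by
    let V : EuclideanSpace ℝ (Fin n) → EuclideanSpace ℝ (Fin n) := fun x =>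
      (-(χ x / (‖fderiv ℝ f x‖ + τ))) • G x
    have hden (x) : 0 < ‖fderiv ℝ f x‖ + τ := by positivity
    have hVcont : Continuous V := by
      refine Continuous.smul (Continuous.neg (hχ.div (by fun_prop) fun x => (hden x).ne')) hGc
    have hVc : HasCompactSupport V := hχc.mono fun x hx h => hx (by simp [V, h])
    have hV1 (x) : ‖V x‖ ≤ 1 := by
      rw [norm_smul, norm_neg, hGn, Real.norm_of_nonneg (div_nonneg (hχ0 x) (hden x).le),
        div_mul_eq_mul_div, div_le_one (hden x)]
      nlinarith [norm_nonneg (fderiv ℝ f x), hχ1 x, hχ0 x]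
    have h1 := hP _ (mollifyField_mem_testFields hη hc hη0 hη1 hVcont hVc hV1)
    have h2 := integral_fderiv_mollify hE hη hc heven hVcont hVc
    rw [← hf] at h2
    have hi : Integrable fun x => χ x * ‖fderiv ℝ f x‖ :=
      (hχ.mul hfc.norm).integrable_of_hasCompactSupport hχc.mul_right
    have h3 : ∫ x, χ x * ‖fderiv ℝ f x‖ - τ * χ x ≤ ∫ x, -(fderiv ℝ f x (V x)) := by
      refine integral_mono (hi.sub (hχi.const_mul τ)) ?_ fun x => ?_
      · refine (Continuous.integrable_of_hasCompactSupport (by fun_prop) ?_).neg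
        exact hVc.mono fun x hx h => hx (by simp [h])
      · simp only [V, map_smul, hGa, smul_eq_mul, neg_mul, neg_neg]
        rw [div_mul_eq_mul_div, le_div_iff₀ (hden x)]
        have := hχ0 x
        nlinarith [mul_nonneg this (sq_nonneg τ)]
    rw [integral_sub hi (hχi.const_mul τ), integral_const_mul, integral_neg, h2] at h3
    linarith
  have hI : 0 ≤ ∫ x, χ x := integral_nonneg hχ0
  refine le_of_forall_pos_le_add fun δ hδ => ?_
  refine (main (δ / ((∫ x, χ x) + 1)) (by positivity)).trans ?_
  gcongr
  rw [div_mul_eq_mul_div, div_le_iff₀ (by positivity)]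
  nlinarith

end Mollify

section Mollifier

variable (n : ℕ)

/-- A smooth bump supported in the ball of radius `2 / (k + 1)`. -/
def smallBump (k : ℕ) : ContDiffBump (0 : EuclideanSpace ℝ (Fin n)) :=
  ⟨1 / (k + 1), 2 / (k + 1), by positivity, by gcongr; norm_num⟩

/-- An even smooth probability density supported in the ball of radius `2 / (k + 1)`. -/
def mollifier (k : ℕ) : EuclideanSpace ℝ (Fin n) → ℝ := (smallBump n k).normed volume

variable {n}

theorem contDiff_mollifier (k : ℕ) : ContDiff ℝ 1 (mollifier n k) :=
  (smallBump n k).contDiff_normed (n := 1)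

theorem hasCompactSupport_mollifier (k : ℕ) : HasCompactSupport (mollifier n k) :=
  (smallBump n k).hasCompactSupport_normed

theorem mollifier_neg (k : ℕ) (x) : mollifier n k (-x) = mollifier n k x :=
  (smallBump n k).normed_neg x

theorem mollifier_nonneg (k : ℕ) (x) : 0 ≤ mollifier n k x :=
  (smallBump n k).nonneg_normed x

theorem integral_mollifier (k : ℕ) : ∫ x, mollifier n k x = 1 :=
  (smallBump n k).integral_normed

theorem tsupport_mollifier (k : ℕ) :
    tsupport (mollifier n k) = Metric.closedBall 0 (2 / (k + 1)) :=
  (smallBump n k).tsupport_normed_eq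

theorem ae_tendsto_mollify {E : Set (EuclideanSpace ℝ (Fin n))} (hE : MeasurableSet E) :
    ∀ᵐ x, Tendsto (fun k => mollify (mollifier n k) E x) atTop (𝓝 (E.indicator (fun _ => 1) x)) := by
  have h := ContDiffBump.ae_convolution_tendsto_right_of_locallyIntegrable
    (φ := fun k => smallBump n k) (l := atTop) (K := 2) (μ := volume) (g := E.indicator fun _ => (1 : ℝ))
    (by
      have := (tendsto_one_div_add_atTop_nhds_zero_nat (𝕜 := ℝ)).const_mul 2
      simpa [smallBump, div_eq_mul_inv] using this)
    (.of_forall fun k => by simp [smallBump, div_eq_mul_inv]) (locallyIntegrable_indicator_one hE)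
  filter_upwards [h] with x hx
  refine hx.congr fun k => ?_
  rw [convolution_eq_swap, mollify, ← integral_indicator hE]
  congr 1; ext t
  by_cases ht : t ∈ E <;> simp [ht, mollifier]

end Mollifier

/-! ### The isoperimetric inequality -/

/-- The **isoperimetric inequality** for the perimeter of De Giorgi, where a bound `P` for the
perimeter is given as a bound for the flux of the test fields of length at most one. -/
theorem sphere_area_le_of_forall_testFields {n : ℕ} (hn : n ≠ 0)
    {E : Set (EuclideanSpace ℝ (Fin n))} (hE : MeasurableSet E) {ρ : ℝ} (hρ : 0 < ρ)
    (hV : volume E = volume (Metric.ball (0 : EuclideanSpace ℝ (Fin n)) ρ)) {P : ℝ}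
    (hP : ∀ φ ∈ testFields (n := n) fun _ => (1 : ℝ), ∫ x in E, vecDiv φ x ≤ P) :
    n * ρ ^ (n - 1) * volume.real (Metric.ball (0 : EuclideanSpace ℝ (Fin n)) 1) ≤ P := by
  have hEt : volume E ≠ ⊤ := by rw [hV]; exact measure_ball_lt_top.ne
  obtain ⟨C, hC0, hC⟩ := exists_norm_fderiv_cutoff_le n
  let f : ℕ → EuclideanSpace ℝ (Fin n) → ℝ := fun k => mollify (mollifier n k) E
  let u : ℕ → EuclideanSpace ℝ (Fin n) → ℝ := fun k x => cutoff k x * f k x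
  have hfd (k) : ContDiff ℝ 1 (f k) :=
    contDiff_mollify hE (contDiff_mollifier k) (hasCompactSupport_mollifier k)
  have hχd (k) : ContDiff ℝ 1 (cutoff (n := n) k) := contDiff_cutoff k (m := 1)
  have hud (k) : ContDiff ℝ 1 (u k) := (hχd k).mul (hfd k)
  have huc (k) : HasCompactSupport (u k) := (hasCompactSupport_cutoff k).mul_right
  have hu0 (k) : 0 ≤ u k := fun x =>
    mul_nonneg (cutoff_nonneg k x) (mollify_nonneg (mollifier_nonneg k) x)
  -- the error comes from the gradient of the cutoff function
  have htv (k : ℕ) : ∫ x, ‖fderiv ℝ (u k) x‖ ≤ P + C / (k + 1) * volume.real E := by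
    have hf0 (x) : 0 ≤ f k x := mollify_nonneg (mollifier_nonneg k) x
    have hfi : Integrable (f k) :=
      integrable_mollify hE hEt (contDiff_mollifier k) (hasCompactSupport_mollifier k)
    have hi : Integrable fun x => cutoff k x * ‖fderiv ℝ (f k) x‖ :=
      ((hχd k).continuous.mul ((hfd k).continuous_fderiv one_ne_zero).norm).integrable_of_hasCompactSupport
        (hasCompactSupport_cutoff k).mul_right
    calc ∫ x, ‖fderiv ℝ (u k) x‖
        ≤ ∫ x, (cutoff k x * ‖fderiv ℝ (f k) x‖ + C / (k + 1) * f k x) := by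
          refine integral_mono (((hud k).continuous_fderiv one_ne_zero).integrable_of_hasCompactSupport
            ((huc k).fderiv (𝕜 := ℝ))).norm (hi.add (hfi.const_mul _)) fun x => ?_
          simp only [u]
          rw [fderiv_fun_mul ((hχd k).differentiable one_ne_zero x)
            ((hfd k).differentiable one_ne_zero x)]
          refine (norm_add_le _ _).trans ?_
          rw [norm_smul, norm_smul, Real.norm_of_nonneg (cutoff_nonneg k x),
            Real.norm_of_nonneg (hf0 x), mul_comm (f k x)]
          have := hf0 x
          gcongr
          exact (hC k x).1
      _ = (∫ x, cutoff k x * ‖fderiv ℝ (f k) x‖) + C / (k + 1) * volume.real E := by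
          rw [integral_add hi (hfi.const_mul _), integral_const_mul, integral_mollify hE hEt
            (contDiff_mollifier k) (hasCompactSupport_mollifier k) (integral_mollifier k)]
      _ ≤ _ := by
          gcongr
          exact integral_mul_norm_fderiv_mollify_le hE (contDiff_mollifier k)
            (hasCompactSupport_mollifier k) (mollifier_neg k) (mollifier_nonneg k)
            (integral_mollifier k) hP (hχd k).continuous (hasCompactSupport_cutoff k)
            (cutoff_nonneg k) (cutoff_le_one k)
  have key (t r : ℝ) (ht0 : 0 < t) (ht1 : t < 1) (hr0 : 0 < r) (hrρ : r < ρ) :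
      t * (n * r ^ (n - 1) * volume.real (Metric.ball (0 : EuclideanSpace ℝ (Fin n)) 1)) ≤ P := by
    -- almost every point of `E` lies in some `F N`, so that `{u k > t}` is eventually larger than
    -- any ball smaller than `E`
    let F : ℕ → Set (EuclideanSpace ℝ (Fin n)) := fun N => {x | ∀ k, N ≤ k → t < u k x}
    have hFm : Monotone F := fun N M hNM x hx k hk => hx k (hNM.trans hk)
    have hEF : E ≤ᵐ[volume] ⋃ N, F N := by
      filter_upwards [ae_tendsto_mollify hE] with x hx hxE
      have hxE' : x ∈ E := hxE
      rw [indicator_of_mem hxE'] at hx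
      have h1 := (tendsto_cutoff x).mul hx
      rw [mul_one] at h1
      obtain ⟨N, hN⟩ := eventually_atTop.1 (h1.eventually (lt_mem_nhds ht1))
      exact mem_iUnion.2 ⟨N, hN⟩
    have hlt : volume (Metric.ball (0 : EuclideanSpace ℝ (Fin n)) r) < volume (⋃ N, F N) := by
      refine lt_of_lt_of_le ?_ (measure_mono_ae hEF)
      rw [hV, Measure.addHaar_ball_of_pos _ _ hr0, Measure.addHaar_ball_of_pos _ _ hρ,
        ENNReal.mul_lt_mul_iff_left (Metric.measure_ball_pos _ _ one_pos).ne'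
        measure_ball_lt_top.ne, ENNReal.ofReal_lt_ofReal_iff (by positivity)]
      exact pow_lt_pow_left₀ hrρ hr0.le (by simpa using hn)
    have hev : ∀ᶠ k : ℕ in atTop, t * (n * r ^ (n - 1) *
        volume.real (Metric.ball (0 : EuclideanSpace ℝ (Fin n)) 1)) ≤
        P + C / (k + 1) * volume.real E := by
      filter_upwards [(tendsto_measure_iUnion_atTop hFm).eventually (lt_mem_nhds hlt)] with k hk
      refine (mul_sphere_area_le_integral_norm_fderiv hn (hud k) (huc k) (hu0 k) ht0 hr0 ?_).trans
        (htv k)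
      exact hk.le.trans (measure_mono fun x hx => hx k le_rfl)
    refine ge_of_tendsto ?_ hev
    have := ((tendsto_one_div_add_atTop_nhds_zero_nat (𝕜 := ℝ)).const_mul
      (C * volume.real E)).const_add P
    simp only [mul_zero, add_zero] at this
    refine this.congr fun k => ?_
    ring
  have hlim : Tendsto (fun s : ℝ => s * (n * (s * ρ) ^ (n - 1) *
      volume.real (Metric.ball (0 : EuclideanSpace ℝ (Fin n)) 1))) (𝓝[<] 1)
      (𝓝 (1 * (n * (1 * ρ) ^ (n - 1) *
      volume.real (Metric.ball (0 : EuclideanSpace ℝ (Fin n)) 1)))) :=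
    (Continuous.tendsto (by fun_prop) _).mono_left nhdsWithin_le_nhds
  rw [one_mul, one_mul] at hlim
  refine le_of_tendsto hlim ?_
  filter_upwards [Ioo_mem_nhdsLT (zero_lt_one' ℝ)] with s hs
  exact key s (s * ρ) hs.1 hs.2 (mul_pos hs.1 hρ) (mul_lt_of_lt_one_left hρ hs.2)


/-! ### Radial vector fields -/

section RadialField

/-- The mean value `(1 / s) ∫₀ˢ p` of `p` over the interval from `0` to `s`, written so that it is
also correct for `s = 0`. -/
def intervalMean (p : ℝ → ℝ) (s : ℝ) : ℝ := ∫ t in (0 : ℝ)..1, p (s * t)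

theorem mul_intervalMean (p : ℝ → ℝ) (s : ℝ) : s * intervalMean p s = ∫ t in (0 : ℝ)..s, p t := by
  simp [intervalMean]

theorem intervalMean_zero (p : ℝ → ℝ) : intervalMean p 0 = p 0 := by simp [intervalMean]

variable {p : ℝ → ℝ}

theorem continuous_intervalMean (hp : Continuous p) : Continuous (intervalMean p) :=
  intervalIntegral.continuous_parametric_intervalIntegral_of_continuous' (by fun_prop) 0 1

theorem intervalMean_eventuallyEq {s : ℝ} (hs : s ≠ 0) :
    intervalMean p =ᶠ[𝓝 s] fun u => (∫ t in (0 : ℝ)..u, p t) / u := by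
  filter_upwards [isOpen_ne.mem_nhds hs] with u hu
  rw [← mul_intervalMean, mul_div_cancel_left₀ _ hu]

theorem hasDerivAt_intervalMean (hp : Continuous p) {s : ℝ} (hs : s ≠ 0) :
    HasDerivAt (intervalMean p) ((p s - intervalMean p s) / s) s := by
  refine HasDerivAt.congr_of_eventuallyEq ?_ (intervalMean_eventuallyEq hs)
  refine ((intervalIntegral.integral_hasDerivAt_right (hp.intervalIntegrable 0 s)
    (hp.stronglyMeasurableAtFilter _ _) hp.continuousAt).div (hasDerivAt_id s) hs).congr_deriv ?_
  rw [← mul_intervalMean]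
  simp only [id]
  field_simp

theorem contDiffAt_intervalMean (hp : Continuous p) {s : ℝ} (hs : s ≠ 0) :
    ContDiffAt ℝ 1 (intervalMean p) s := by
  refine ContDiffAt.congr_of_eventuallyEq ?_ (intervalMean_eventuallyEq hs)
  refine ContDiffAt.div ?_ contDiffAt_id hs
  refine ContDiff.contDiffAt (contDiff_one_iff_deriv.2 ⟨fun u =>
    (intervalIntegral.integral_hasDerivAt_right (hp.intervalIntegrable 0 u)
    (hp.stronglyMeasurableAtFilter _ _) hp.continuousAt).differentiableAt, ?_⟩)
  have : (deriv fun u => ∫ t in (0 : ℝ)..u, p t) = p := funext fun u => hp.deriv_integral _ 0 u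
  rwa [this]

theorem intervalMean_nonneg (hp0 : ∀ s, 0 ≤ p s) (s : ℝ) : 0 ≤ intervalMean p s :=
  intervalIntegral.integral_nonneg zero_le_one fun _ _ => hp0 _

theorem intervalMean_mono {q : ℝ → ℝ} (hp : Continuous p) (hq : Continuous q)
    (hpq : ∀ s, p s ≤ q s) (s : ℝ) : intervalMean p s ≤ intervalMean q s :=
  intervalIntegral.integral_mono zero_le_one (Continuous.intervalIntegrable (by fun_prop) _ _)
    (Continuous.intervalIntegrable (by fun_prop) _ _) fun _ => hpq _

theorem intervalMean_le {M : ℝ} (hp : Continuous p) (hpM : ∀ s, p s ≤ M) (s : ℝ) :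
    intervalMean p s ≤ M := by
  refine (intervalMean_mono hp continuous_const hpM s).trans_eq ?_
  simp [intervalMean]

variable {n : ℕ}

/-- The radial vector field on `ℝⁿ` whose divergence is `n p(‖x‖ⁿ)`. -/
def radialField (n : ℕ) (p : ℝ → ℝ) (x : EuclideanSpace ℝ (Fin n)) : EuclideanSpace ℝ (Fin n) :=
  intervalMean p (‖x‖ ^ n) • x

theorem hasFDerivAt_radialField (hp : Continuous p) {x : EuclideanSpace ℝ (Fin n)} (hx : x ≠ 0) :
    HasFDerivAt (radialField n p)
      (intervalMean p (‖x‖ ^ n) • ContinuousLinearMap.id ℝ _ +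
        (((p (‖x‖ ^ n) - intervalMean p (‖x‖ ^ n)) / ‖x‖ ^ n) •
          ((n * ‖x‖ ^ (n - 1)) • fderiv ℝ (fun y => ‖y‖) x)).smulRight x) x := by
  have h1 : HasFDerivAt (fun y : EuclideanSpace ℝ (Fin n) => ‖y‖) (fderiv ℝ (fun y => ‖y‖) x) x :=
    ((contDiffAt_norm ℝ hx (n := 1)).differentiableAt one_ne_zero).hasFDerivAt
  have h2 := (hasDerivAt_pow n ‖x‖).comp_hasFDerivAt x h1
  have hs : ‖x‖ ^ n ≠ 0 := pow_ne_zero _ (norm_ne_zero_iff.2 hx)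
  exact ((hasDerivAt_intervalMean hp hs).comp_hasFDerivAt x h2).smul (hasFDerivAt_id x)

theorem hasFDerivAt_radialField_zero (hn : n ≠ 0) (hp : Continuous p) :
    HasFDerivAt (radialField n p) (p 0 • ContinuousLinearMap.id ℝ _) 0 := by
  have h : Tendsto (fun x : EuclideanSpace ℝ (Fin n) => intervalMean p (‖x‖ ^ n) - p 0) (𝓝 0)
      (𝓝 0) := by
    have : Continuous (fun x : EuclideanSpace ℝ (Fin n) => intervalMean p (‖x‖ ^ n) - p 0) := by
      have := continuous_intervalMean hp
      fun_prop
    simpa [hn, intervalMean_zero] using this.tendsto 0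
  rw [hasFDerivAt_iff_isLittleO_nhds_zero]
  have := ((Asymptotics.isLittleO_one_iff ℝ).2 h).smul_isBigO
    (Asymptotics.isBigO_refl (fun x : EuclideanSpace ℝ (Fin n) => x) (𝓝 0))
  simpa [radialField, sub_smul] using this

/-- The right-hand side tends to zero at the origin, so the derivative of the radial field is
continuous there. -/
theorem norm_fderiv_radialField_sub_le (hn : n ≠ 0) (hp : Continuous p)
    (x : EuclideanSpace ℝ (Fin n)) :
    ‖fderiv ℝ (radialField n p) x - p 0 • ContinuousLinearMap.id ℝ _‖ ≤
      |intervalMean p (‖x‖ ^ n) - p 0| + n * |p (‖x‖ ^ n) - intervalMean p (‖x‖ ^ n)| := by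
  rcases eq_or_ne x 0 with rfl | hx
  · rw [(hasFDerivAt_radialField_zero hn hp).fderiv, sub_self, norm_zero]
    positivity
  have hx' : 0 < ‖x‖ := norm_pos_iff.2 hx
  rw [(hasFDerivAt_radialField hp hx).fderiv, add_sub_right_comm]
  refine (norm_add_le _ _).trans ?_
  gcongr
  · have : intervalMean p (‖x‖ ^ n) • ContinuousLinearMap.id ℝ (EuclideanSpace ℝ (Fin n)) -
        p 0 • ContinuousLinearMap.id ℝ _ =
        (intervalMean p (‖x‖ ^ n) - p 0) • ContinuousLinearMap.id ℝ _ := (sub_smul _ _ _).symm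
    rw [this, norm_smul]
    exact mul_le_of_le_one_right (norm_nonneg _) ContinuousLinearMap.norm_id_le
  · rw [ContinuousLinearMap.norm_smulRight_apply, norm_smul, norm_smul, Real.norm_eq_abs, abs_div,
      Real.norm_of_nonneg (by positivity : (0 : ℝ) ≤ n * ‖x‖ ^ (n - 1)),
      abs_of_nonneg (by positivity : (0 : ℝ) ≤ ‖x‖ ^ n)]
    have h1 : ‖fderiv ℝ (fun y : EuclideanSpace ℝ (Fin n) => ‖y‖) x‖ ≤ 1 :=
      NNReal.coe_one ▸ norm_fderiv_le_of_lipschitz ℝ lipschitzWith_one_norm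
    have h2 : ‖x‖ ^ n = ‖x‖ ^ (n - 1) * ‖x‖ := by rw [← pow_succ, Nat.sub_add_cancel (by omega)]
    calc _ ≤ |p (‖x‖ ^ n) - intervalMean p (‖x‖ ^ n)| / ‖x‖ ^ n * (n * ‖x‖ ^ (n - 1) * 1) * ‖x‖ := by
          gcongr
      _ = _ := by
          generalize |p (‖x‖ ^ n) - intervalMean p (‖x‖ ^ n)| = d
          rw [h2]; field_simp

theorem contDiff_radialField (hn : n ≠ 0) (hp : Continuous p) : ContDiff ℝ 1 (radialField n p) := by
  rw [contDiff_one_iff_fderiv]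
  constructor
  · intro x
    rcases eq_or_ne x 0 with rfl | hx
    · exact (hasFDerivAt_radialField_zero hn hp).differentiableAt
    · exact (hasFDerivAt_radialField hp hx).differentiableAt
  rw [continuous_iff_continuousAt]
  intro x
  rcases eq_or_ne x 0 with rfl | hx
  · rw [ContinuousAt, (hasFDerivAt_radialField_zero hn hp).fderiv, tendsto_iff_norm_sub_tendsto_zero]
    refine squeeze_zero (fun _ => norm_nonneg _) (norm_fderiv_radialField_sub_le hn hp) ?_
    have : Continuous fun x : EuclideanSpace ℝ (Fin n) => |intervalMean p (‖x‖ ^ n) - p 0| +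
        n * |p (‖x‖ ^ n) - intervalMean p (‖x‖ ^ n)| := by
      have := continuous_intervalMean hp
      fun_prop
    simpa [hn, intervalMean_zero] using this.tendsto 0
  · have hs : ‖x‖ ^ n ≠ 0 := pow_ne_zero _ (norm_ne_zero_iff.2 hx)
    have : ContDiffAt ℝ 1 (radialField n p) x :=
      ((contDiffAt_intervalMean hp hs).comp x ((contDiffAt_norm ℝ hx).pow n)).smul contDiffAt_id
    exact (this.fderiv_right (m := 0) (by norm_num)).continuousAt

theorem vecDiv_radialField (hn : n ≠ 0) (hp : Continuous p) (x : EuclideanSpace ℝ (Fin n)) :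
    vecDiv (radialField n p) x = n * p (‖x‖ ^ n) := by
  rcases eq_or_ne x 0 with rfl | hx
  · simp [vecDiv, (hasFDerivAt_radialField_zero hn hp).fderiv, hn]
  · have hx' : 0 < ‖x‖ := norm_pos_iff.2 hx
    have h1 : fderiv ℝ (fun y : EuclideanSpace ℝ (Fin n) => ‖y‖) x x = ‖x‖ :=
      ((contDiffAt_norm ℝ hx (n := 1)).differentiableAt one_ne_zero).fderiv_norm_self
    have h2 : ‖x‖ ^ n = ‖x‖ ^ (n - 1) * ‖x‖ := by rw [← pow_succ, Nat.sub_add_cancel (by omega)]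
    simp only [vecDiv, (hasFDerivAt_radialField hp hx).fderiv, add_apply,
      ContinuousLinearMap.smulRight_apply, smul_apply, PiLp.add_apply, PiLp.smul_apply, smul_eq_mul,
      Finset.sum_add_distrib, mul_assoc, ← Finset.mul_sum, sum_clm_single_mul, h1]
    simp
    generalize p (‖x‖ ^ n) = d
    generalize intervalMean p (‖x‖ ^ n) = e
    rw [h2]; field_simp; ring

theorem norm_radialField (hp0 : ∀ s, 0 ≤ p s) (x : EuclideanSpace ℝ (Fin n)) :
    ‖radialField n p x‖ = ‖x‖ * intervalMean p (‖x‖ ^ n) := by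
  rw [radialField, norm_smul, Real.norm_of_nonneg (intervalMean_nonneg hp0 _), mul_comm]

/-- The flux of the radial field out of the ball of radius `ρ` is its length on the sphere times the
area of the sphere. -/
theorem setIntegral_ball_radial (hn : n ≠ 0) (hp : Continuous p) {ρ : ℝ} (hρ : 0 < ρ) :
    ∫ x in Metric.ball (0 : EuclideanSpace ℝ (Fin n)) ρ, n * p (‖x‖ ^ n) =
      n * (ρ * intervalMean p (ρ ^ n)) * ρ ^ (n - 1) *
        volume.real (Metric.ball (0 : EuclideanSpace ℝ (Fin n)) 1) := by
  have hnt : Nontrivial (EuclideanSpace ℝ (Fin n)) := by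
    have : NeZero n := ⟨hn⟩
    infer_instance
  have e1 : ∫ x in Metric.ball (0 : EuclideanSpace ℝ (Fin n)) ρ, n * p (‖x‖ ^ n) =
      ∫ x : EuclideanSpace ℝ (Fin n), (Iio ρ).indicator (fun r => n * p (r ^ n)) ‖x‖ := by
    rw [← integral_indicator Metric.isOpen_ball.measurableSet]
    congr 1; ext x
    by_cases h : ‖x‖ < ρ <;> simp [h]
  have e2 : ∫ y in Ioi (0 : ℝ), y ^ (n - 1) • (Iio ρ).indicator (fun r => n * p (r ^ n)) y =
      ∫ y in (0 : ℝ)..ρ, p (y ^ n) * (n * y ^ (n - 1)) := by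
    rw [intervalIntegral.integral_of_le hρ.le, integral_Ioc_eq_integral_Ioo,
      ← Ioi_inter_Iio, ← setIntegral_indicator measurableSet_Iio]
    congr 1; ext y
    by_cases h : y < ρ <;> simp [h]
    ring
  have e3 : ∫ y in (0 : ℝ)..ρ, p (y ^ n) * (n * y ^ (n - 1)) = ∫ t in (0 : ℝ)..(ρ ^ n), p t := by
    have := intervalIntegral.integral_comp_mul_deriv (a := 0) (b := ρ) (f := fun y : ℝ => y ^ n)
      (f' := fun y => n * y ^ (n - 1)) (g := p) (fun y _ => hasDerivAt_pow n y)
      (by fun_prop) hp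
    simpa [hn] using this
  rw [e1, integral_fun_norm_addHaar, finrank_euclideanSpace_fin, e2, e3, ← mul_intervalMean]
  have h2 : ρ ^ n = ρ ^ (n - 1) * ρ := by rw [← pow_succ, Nat.sub_add_cancel (by omega)]
  generalize intervalMean p (ρ ^ n) = e
  rw [h2]
  simp
  ring

end RadialField

/-- Among sets of given volume, the centred ball minimizes the integral of a nondecreasing bounded
function of the norm. -/
theorem setIntegral_ball_le_setIntegral {n : ℕ} {E : Set (EuclideanSpace ℝ (Fin n))}
    (hE : MeasurableSet E) {ρ : ℝ}
    (hV : volume E = volume (Metric.ball (0 : EuclideanSpace ℝ (Fin n)) ρ))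
    {g : ℝ → ℝ} (hg : Monotone g) {M : ℝ} (hgM : ∀ s, |g s| ≤ M) :
    ∫ x in Metric.ball (0 : EuclideanSpace ℝ (Fin n)) ρ, g ‖x‖ ≤ ∫ x in E, g ‖x‖ := by
  set B := Metric.ball (0 : EuclideanSpace ℝ (Fin n)) ρ with hB
  have hBm : MeasurableSet B := Metric.isOpen_ball.measurableSet
  have hBt : volume B ≠ ⊤ := measure_ball_lt_top.ne
  have hEt : volume E ≠ ⊤ := hV ▸ hBt
  have hm : Measurable fun x : EuclideanSpace ℝ (Fin n) => g ‖x‖ := hg.measurable.comp measurable_norm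
  have hi (S : Set (EuclideanSpace ℝ (Fin n))) (hS : volume S ≠ ⊤) :
      IntegrableOn (fun x => g ‖x‖) S :=
    Measure.integrableOn_of_bounded hS hm.aestronglyMeasurable (.of_forall fun x => hgM _)
  have hi' (S : Set (EuclideanSpace ℝ (Fin n))) (hS : volume S ≠ ⊤) :
      IntegrableOn (fun x => g ‖x‖ - g ρ) S := (hi S hS).sub (integrableOn_const hS)
  have key : ∫ x in B, (g ‖x‖ - g ρ) ≤ ∫ x in E, (g ‖x‖ - g ρ) := by
    rw [← integral_inter_add_sdiff hE (hi' B hBt), ← integral_inter_add_sdiff hBm (hi' E hEt),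
      inter_comm E B]
    have h1 : ∫ x in B \ E, (g ‖x‖ - g ρ) ≤ 0 :=
      setIntegral_nonpos (hBm.diff hE) fun x hx => by
        have : ‖x‖ < ρ := by simpa [hB] using hx.1
        linarith [hg this.le]
    have h2 : 0 ≤ ∫ x in E \ B, (g ‖x‖ - g ρ) :=
      setIntegral_nonneg (hE.diff hBm) fun x hx => by
        have : ρ ≤ ‖x‖ := by simpa [hB] using hx.2
        linarith [hg this]
    linarith
  rw [integral_sub (hi B hBt) (integrableOn_const hBt), integral_sub (hi E hEt)
    (integrableOn_const hEt)] at key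
  simp only [setIntegral_const, Measure.real, hV] at key
  linarith

/-- Cutoff functions do not change the flux of a field of linear growth in the limit. -/
theorem tendsto_setIntegral_vecDiv_cutoff {n : ℕ} {E : Set (EuclideanSpace ℝ (Fin n))}
    (hEt : volume E ≠ ⊤)
    {Φ : EuclideanSpace ℝ (Fin n) → EuclideanSpace ℝ (Fin n)} (hΦ : ContDiff ℝ 1 Φ) {M : ℝ}
    (hΦM : ∀ x, ‖Φ x‖ ≤ M * ‖x‖) {M' : ℝ} (hΦM' : ∀ x, |vecDiv Φ x| ≤ M') :
    Tendsto (fun k => ∫ x in E, vecDiv (fun y => cutoff k y • Φ y) x) atTop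
      (𝓝 (∫ x in E, vecDiv Φ x)) := by
  obtain ⟨C, hC0, hC⟩ := exists_norm_fderiv_cutoff_le n
  have hd (k) (x) : vecDiv (fun y => cutoff k y • Φ y) x =
      cutoff k x * vecDiv Φ x + fderiv ℝ (cutoff k) x (Φ x) :=
    vecDiv_smul ((contDiff_cutoff k (m := 1)).differentiable one_ne_zero x)
      (hΦ.differentiable one_ne_zero x)
  have hfin : IsFiniteMeasure (volume.restrict E) := ⟨by simpa using hEt.lt_top⟩
  refine tendsto_integral_of_dominated_convergence (fun _ => M' + |M| * C) (fun k => ?_)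
    (integrable_const _) (fun k => .of_forall fun x => ?_) (.of_forall fun x => ?_)
  · exact (continuous_vecDiv ((contDiff_cutoff k (m := 1)).smul hΦ)).aestronglyMeasurable
  · rw [hd, Real.norm_eq_abs]
    refine (abs_add_le _ _).trans (add_le_add ?_ ?_)
    · rw [abs_mul, abs_of_nonneg (cutoff_nonneg k x)]
      exact (mul_le_of_le_one_left (abs_nonneg _) (cutoff_le_one k x)).trans (hΦM' x)
    · calc |fderiv ℝ (cutoff k) x (Φ x)| ≤ ‖fderiv ℝ (cutoff k) x‖ * ‖Φ x‖ :=
            (Real.norm_eq_abs _).symm.le.trans (ContinuousLinearMap.le_opNorm _ _)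
        _ ≤ ‖fderiv ℝ (cutoff k) x‖ * (|M| * ‖x‖) := by
            gcongr
            exact (hΦM x).trans (by gcongr; exact le_abs_self M)
        _ = |M| * (‖fderiv ℝ (cutoff k) x‖ * ‖x‖) := by ring
        _ ≤ |M| * C := by gcongr; exact (hC k x).2
  · refine tendsto_const_nhds.congr' ?_
    obtain ⟨N, hN⟩ := exists_nat_gt ‖x‖
    filter_upwards [eventually_ge_atTop N] with k hk
    have hk' : (N : ℝ) ≤ k := by exact_mod_cast hk
    have hx : ‖x‖ < k + 1 := by linarith
    rw [hd, cutoff_eq_one hx, fderiv_cutoff_eq_zero hx]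
    simp


/-! ### The divergence theorem on a ball -/

theorem integral_vecDiv_eq_zero {n : ℕ}
    {ψ : EuclideanSpace ℝ (Fin n) → EuclideanSpace ℝ (Fin n)} (hψ : ContDiff ℝ 1 ψ)
    (hc : HasCompactSupport ψ) : ∫ x, vecDiv ψ x = 0 := by
  have hd (i : Fin n) (x v : EuclideanSpace ℝ (Fin n)) :
      fderiv ℝ (fun y => ψ y i) x v = (fderiv ℝ ψ x v) i := by
    have := ((EuclideanSpace.proj i : EuclideanSpace ℝ (Fin n) →L[ℝ] ℝ).hasFDerivAt.comp x
      (hψ.differentiable one_ne_zero x).hasFDerivAt).fderiv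
    exact congrArg (fun l => l v) this
  have hDi (i : Fin n) (v : EuclideanSpace ℝ (Fin n)) :
      Integrable fun x => (fderiv ℝ ψ x v) i := by
    have := hψ.continuous_fderiv one_ne_zero
    exact Continuous.integrable_of_hasCompactSupport (by fun_prop)
      ((hc.fderiv (𝕜 := ℝ)).mono fun x hx h => hx (by simp [h]))
  have hsm (i : Fin n) : ContDiff ℝ 1 fun y => ψ y i :=
    (EuclideanSpace.proj i : EuclideanSpace ℝ (Fin n) →L[ℝ] ℝ).contDiff.comp hψ
  unfold vecDiv
  rw [integral_finsetSum _ fun i _ => hDi i _]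
  refine Finset.sum_eq_zero fun i _ => ?_
  have := integral_mul_fderiv_eq_neg_fderiv_mul_of_integrable (μ := volume)
    (f := fun _ : EuclideanSpace ℝ (Fin n) => (1 : ℝ)) (g := fun y => ψ y i)
    (v := EuclideanSpace.single i 1) (by simp) (by simpa [hd] using hDi i _)
    (by
      simp only [one_mul]
      exact (hsm i).continuous.integrable_of_hasCompactSupport
        (hc.mono fun x hx h => hx (by simp [h])))
    (fun _ _ => differentiableAt_const _) (fun x _ => (hsm i).differentiable one_ne_zero x)
  simpa [hd] using this

/-- Smooth approximations from below of the indicator function of the interval below `ρ ^ 2`. -/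
def ballProfile (ρ : ℝ) (k : ℕ) (s : ℝ) : ℝ := Real.smoothTransition ((k + 1) * (ρ ^ 2 - s))

theorem contDiff_ballProfile (ρ : ℝ) (k : ℕ) : ContDiff ℝ 1 (ballProfile ρ k) :=
  (Real.smoothTransition.contDiff (n := 1)).comp (by fun_prop)

theorem antitone_ballProfile (ρ : ℝ) (k : ℕ) : Antitone (ballProfile ρ k) := fun s t hst =>
  Real.smoothTransition.monotone (by gcongr)

theorem ballProfile_eq_zero {ρ : ℝ} {k : ℕ} {s : ℝ} (hs : ρ ^ 2 ≤ s) : ballProfile ρ k s = 0 :=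
  Real.smoothTransition.zero_of_nonpos (mul_nonpos_of_nonneg_of_nonpos (by positivity) (by linarith))

theorem deriv_ballProfile_eq_zero {ρ : ℝ} {k : ℕ} {s : ℝ} (hs : ρ ^ 2 < s) :
    deriv (ballProfile ρ k) s = 0 := by
  have : ballProfile ρ k =ᶠ[𝓝 s] fun _ => 0 := by
    filter_upwards [lt_mem_nhds hs] with t ht using ballProfile_eq_zero ht.le
  rw [this.deriv_eq, deriv_const]

/-- The divergence theorem on a ball, as an upper bound for the flux through the sphere. -/
theorem setIntegral_ball_vecDiv_le {n : ℕ} (hn : n ≠ 0)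
    {φ : EuclideanSpace ℝ (Fin n) → EuclideanSpace ℝ (Fin n)} (hφ : ContDiff ℝ 1 φ)
    (hc : HasCompactSupport φ) {c ρ : ℝ} (hc0 : 0 ≤ c) (hρ : 0 < ρ)
    (hb : ∀ x, ‖x‖ ≤ ρ → ‖φ x‖ ≤ c) :
    ∫ x in Metric.ball (0 : EuclideanSpace ℝ (Fin n)) ρ, vecDiv φ x ≤
      n * c * ρ ^ (n - 1) * volume.real (Metric.ball (0 : EuclideanSpace ℝ (Fin n)) 1) := by
  have hnt : Nontrivial (EuclideanSpace ℝ (Fin n)) := by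
    have : NeZero n := ⟨hn⟩
    infer_instance
  let q := ballProfile ρ
  -- `-w` is the radial derivative of the function `η` below, which approximates the indicator
  -- function of the ball
  let w : ℕ → ℝ → ℝ := fun k r => -(deriv (q k) (r ^ 2) * (2 * r))
  have hdq (k) : Continuous (deriv (q k)) := (contDiff_ballProfile ρ k).continuous_deriv_one
  have hq (k) (s) : HasDerivAt (q k) (deriv (q k) s) s :=
    ((contDiff_ballProfile ρ k).differentiable one_ne_zero s).hasDerivAt
  have hdq0 (k) (s) : deriv (q k) s ≤ 0 := (antitone_ballProfile ρ k).deriv_nonpos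
  have hwc (k) : Continuous (w k) := by
    have := hdq k
    fun_prop
  have hw0 (k) (r : ℝ) (hr : 0 ≤ r) : 0 ≤ w k r :=
    neg_nonneg.2 (mul_nonpos_of_nonpos_of_nonneg (hdq0 k _) (by positivity))
  have hwz (k) (r : ℝ) (hr : ρ < r) : w k r = 0 := by
    simp only [w, q]
    rw [deriv_ballProfile_eq_zero (by gcongr)]; simp
  have hwi (k) : Integrable fun x : EuclideanSpace ℝ (Fin n) => w k ‖x‖ := by
    refine Continuous.integrable_of_hasCompactSupport ((hwc k).comp continuous_norm)
      (HasCompactSupport.intro (isCompact_closedBall (0 : EuclideanSpace ℝ (Fin n)) ρ) fun x hx => ?_)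
    exact hwz k _ (by simpa using hx)
  have hint (k) : ∫ x : EuclideanSpace ℝ (Fin n), w k ‖x‖ ≤
      n * ρ ^ (n - 1) * volume.real (Metric.ball (0 : EuclideanSpace ℝ (Fin n)) 1) := by
    have h1 : ∫ y in Ioi (0 : ℝ), y ^ (n - 1) • w k y ≤ ρ ^ (n - 1) := by
      calc ∫ y in Ioi (0 : ℝ), y ^ (n - 1) • w k y
          = ∫ y in Ioc 0 ρ, y ^ (n - 1) • w k y := by
            refine setIntegral_eq_of_subset_of_forall_sdiff_eq_zero measurableSet_Ioi
              Ioc_subset_Ioi_self fun y hy => ?_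
            rw [hwz k y, smul_zero]
            by_contra h
            exact hy.2 ⟨hy.1, not_lt.1 h⟩
        _ ≤ ∫ y in Ioc 0 ρ, ρ ^ (n - 1) * w k y := by
            refine setIntegral_mono_on ?_ ?_ measurableSet_Ioc fun y hy => ?_
            · exact (Continuous.integrableOn_Icc (by have := hwc k; fun_prop)).mono_set
                Ioc_subset_Icc_self
            · exact (Continuous.integrableOn_Icc (by have := hwc k; fun_prop)).mono_set
                Ioc_subset_Icc_self
            · have := hw0 k y hy.1.le
              have h0 := hy.1.le
              have h1 := hy.2
              rw [smul_eq_mul]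
              gcongr
        _ = ρ ^ (n - 1) * (q k 0 - q k (ρ ^ 2)) := by
            rw [integral_const_mul, ← intervalIntegral.integral_of_le hρ.le,
              intervalIntegral.integral_eq_sub_of_hasDerivAt (f := fun r => -(q k (r ^ 2)))
              (fun r _ => ?_) ((hwc k).intervalIntegrable _ _)]
            · rw [zero_pow two_ne_zero]; ring
            · have := ((hq k (r ^ 2)).comp r (hasDerivAt_pow 2 r)).neg
              refine this.congr_deriv ?_
              simp [w]
        _ ≤ ρ ^ (n - 1) * 1 := by
            have h1 : q k 0 ≤ 1 := Real.smoothTransition.le_one _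
            have h2 : 0 ≤ q k (ρ ^ 2) := Real.smoothTransition.nonneg _
            gcongr; linarith
        _ = _ := mul_one _
    rw [integral_fun_norm_addHaar, finrank_euclideanSpace_fin, nsmul_eq_mul, smul_eq_mul]
    calc _ ≤ (n : ℝ) * (volume.real (Metric.ball (0 : EuclideanSpace ℝ (Fin n)) 1) *
          ρ ^ (n - 1)) := by gcongr
      _ = _ := by ring
  let η : ℕ → EuclideanSpace ℝ (Fin n) → ℝ := fun k x => q k (‖x‖ ^ 2)
  have hηd (k) : ContDiff ℝ 1 (η k) := (contDiff_ballProfile ρ k).comp (contDiff_norm_sq ℝ)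
  have hDη (k) (x v : EuclideanSpace ℝ (Fin n)) :
      fderiv ℝ (η k) x v = deriv (q k) (‖x‖ ^ 2) * (2 * inner ℝ x v) := by
    have := (hq k (‖x‖ ^ 2)).comp_hasFDerivAt x (hasStrictFDerivAt_norm_sq x).hasFDerivAt
    have e : q k ∘ (fun x : EuclideanSpace ℝ (Fin n) => ‖x‖ ^ 2) = η k := rfl
    rw [← e, this.fderiv]
    simp
  have hbound (k) : ∫ x, η k x * vecDiv φ x ≤ n * c * ρ ^ (n - 1) *
      volume.real (Metric.ball (0 : EuclideanSpace ℝ (Fin n)) 1) := by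
    have hz := integral_vecDiv_eq_zero ((hηd k).smul hφ) hc.smul_left
    have hdiv (x) : vecDiv (fun y => η k y • φ y) x = η k x * vecDiv φ x + fderiv ℝ (η k) x (φ x) :=
      vecDiv_smul ((hηd k).differentiable one_ne_zero x) (hφ.differentiable one_ne_zero x)
    have hi1 : Integrable fun x => η k x * vecDiv φ x :=
      ((hηd k).continuous.mul (continuous_vecDiv hφ)).integrable_of_hasCompactSupport
        (hasCompactSupport_vecDiv hc).mul_left
    have hi2 : Integrable fun x => fderiv ℝ (η k) x (φ x) := by
      have := (hηd k).continuous_fderiv one_ne_zero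
      have := hφ.continuous
      exact Continuous.integrable_of_hasCompactSupport (by fun_prop)
        (hc.mono fun x hx h => hx (by simp [h]))
    have hz' : (∫ x, η k x * vecDiv φ x) + ∫ x, fderiv ℝ (η k) x (φ x) = 0 := by
      rw [← integral_add hi1 hi2, ← hz]
      congr 1; ext x; exact (hdiv x).symm
    have hle : ∫ x, -(fderiv ℝ (η k) x (φ x)) ≤
        ∫ x : EuclideanSpace ℝ (Fin n), c * w k ‖x‖ := by
      refine integral_mono hi2.neg ((hwi k).const_mul c) fun x => ?_
      simp only [hDη]
      rcases le_or_gt ‖x‖ ρ with hx | hx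
      · have h1 : inner ℝ x (φ x) ≤ ‖x‖ * c :=
          (real_inner_le_norm _ _).trans (by gcongr; exact hb x hx)
        have h2 := hdq0 k (‖x‖ ^ 2)
        simp only [w]
        nlinarith
      · rw [hwz k _ hx, mul_zero]
        simp only [q]
        rw [deriv_ballProfile_eq_zero (by gcongr)]; simp
    rw [integral_neg, integral_const_mul] at hle
    have := mul_le_mul_of_nonneg_left (hint k) hc0
    calc _ ≤ _ := by linarith
      _ ≤ _ := hle
      _ ≤ _ := this
      _ = _ := by ring
  have hlim : Tendsto (fun k => ∫ x, η k x * vecDiv φ x) atTop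
      (𝓝 (∫ x, (Metric.ball (0 : EuclideanSpace ℝ (Fin n)) ρ).indicator (vecDiv φ) x)) := by
    refine tendsto_integral_of_dominated_convergence (fun x => ‖vecDiv φ x‖) (fun k => ?_)
      (integrable_vecDiv hφ hc).norm (fun k => .of_forall fun x => ?_) (.of_forall fun x => ?_)
    · exact ((hηd k).continuous.mul (continuous_vecDiv hφ)).aestronglyMeasurable
    · have : 0 ≤ η k x := Real.smoothTransition.nonneg _
      rw [norm_mul, Real.norm_of_nonneg this]
      exact mul_le_of_le_one_left (norm_nonneg _) (Real.smoothTransition.le_one _)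
    · rcases lt_or_ge ‖x‖ ρ with hx | hx
      · rw [indicator_of_mem (by simpa using hx)]
        have hpos : 0 < ρ ^ 2 - ‖x‖ ^ 2 := by
          have : ‖x‖ ^ 2 < ρ ^ 2 := by gcongr
          linarith
        refine tendsto_const_nhds.congr' ?_
        obtain ⟨N, hN⟩ := exists_nat_gt (ρ ^ 2 - ‖x‖ ^ 2)⁻¹
        filter_upwards [eventually_ge_atTop N] with k hk
        have hk' : (N : ℝ) ≤ k := by exact_mod_cast hk
        have : η k x = 1 := by
          refine Real.smoothTransition.one_of_one_le ?_
          rw [← inv_le_iff_one_le_mul₀ hpos]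
          linarith
        rw [this, one_mul]
      · rw [indicator_of_notMem (by simpa using hx)]
        have this (k : ℕ) : η k x = 0 := ballProfile_eq_zero (by gcongr)
        simp [this]
  rw [integral_indicator Metric.isOpen_ball.measurableSet] at hlim
  exact le_of_tendsto hlim (.of_forall hbound)


/-! ### Calibration and the lower bound for the surface area -/

theorem integral_vecDiv_le_of_weightedPerimeter_le {n : ℕ} {f : EuclideanSpace ℝ (Fin n) → ℝ}
    {E : Set (EuclideanSpace ℝ (Fin n))} {P : ℝ} (hP0 : 0 ≤ P)
    (hP : weightedPerimeter f E ≤ ENNReal.ofReal P)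
    {φ : EuclideanSpace ℝ (Fin n) → EuclideanSpace ℝ (Fin n)} (hφ : φ ∈ testFields f) :
    ∫ x in E, vecDiv φ x ≤ P :=
  (ENNReal.ofReal_le_ofReal_iff hP0).1
    ((le_iSup₂ (f := fun φ (_ : φ ∈ testFields f) => ENNReal.ofReal (∫ x in E, vecDiv φ x)) φ hφ).trans hP)

/-- Surface area is superadditive in the density, as test fields for two densities can be added;
the constant part of the density contributes at least the area of the sphere. -/
theorem mul_sphere_area_add_le {n : ℕ} (hn : n ≠ 0) {c : ℝ} (hc : 0 ≤ c)
    {b : EuclideanSpace ℝ (Fin n) → ℝ} {E : Set (EuclideanSpace ℝ (Fin n))}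
    (hE : MeasurableSet E) {ρ : ℝ} (hρ : 0 < ρ)
    (hV : volume E = volume (Metric.ball (0 : EuclideanSpace ℝ (Fin n)) ρ)) {P : ℝ} (hP0 : 0 ≤ P)
    (hP : weightedPerimeter (fun x => c + b x) E ≤ ENNReal.ofReal P)
    {φ : EuclideanSpace ℝ (Fin n) → EuclideanSpace ℝ (Fin n)} (hφ : φ ∈ testFields b) :
    c * (n * ρ ^ (n - 1) * volume.real (Metric.ball (0 : EuclideanSpace ℝ (Fin n)) 1)) +
      ∫ x in E, vecDiv φ x ≤ P := by
  obtain ⟨hφ1, hφc, hφb⟩ := hφ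
  have key (ψ) (hψ : ψ ∈ testFields (n := n) fun _ => (1 : ℝ)) :
      c * (∫ x in E, vecDiv ψ x) + ∫ x in E, vecDiv φ x ≤ P := by
    obtain ⟨hψ1, hψc, hψb⟩ := hψ
    have hcψ : ContDiff ℝ 1 fun x => c • ψ x := hψ1.const_smul c
    have hmem : (fun x => c • ψ x + φ x) ∈ testFields fun x => c + b x := by
      refine ⟨hcψ.add hφ1, (hψc.smul_left (f := fun _ => c)).add hφc,
        fun x => ?_⟩
      refine (norm_add_le _ _).trans (add_le_add ?_ (hφb x))
      rw [norm_smul, Real.norm_of_nonneg hc]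
      exact mul_le_of_le_one_right hc (hψb x)
    have := integral_vecDiv_le_of_weightedPerimeter_le hP0 hP hmem
    have hd (x) : vecDiv (fun x => c • ψ x + φ x) x = c * vecDiv ψ x + vecDiv φ x := by
      rw [vecDiv_add (hcψ.differentiable one_ne_zero x) (hφ1.differentiable one_ne_zero x),
        vecDiv_const_smul c (hψ1.differentiable one_ne_zero x)]
    simp only [hd] at this
    rwa [integral_add ((integrable_vecDiv hψ1 hψc).integrableOn.const_mul c)
      (integrable_vecDiv hφ1 hφc).integrableOn, integral_const_mul] at this
  rcases hc.eq_or_lt with rfl | hc'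
  · have := key 0 ⟨contDiff_const, HasCompactSupport.zero, fun x => by simp⟩
    simpa using this
  · have := sphere_area_le_of_forall_testFields hn hE hρ hV
      (P := (P - ∫ x in E, vecDiv φ x) / c) fun ψ hψ => by
        rw [le_div_iff₀ hc']
        linarith [key ψ hψ]
    rw [le_div_iff₀ hc'] at this
    linarith

section Calibration

variable {n : ℕ} {p : ℝ → ℝ}

/-- The length of the radial field with divergence `n p(‖x‖ⁿ)`, as a density on `ℝⁿ`. -/
def radialDensity (n : ℕ) (p : ℝ → ℝ) (x : EuclideanSpace ℝ (Fin n)) : ℝ :=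
  ‖x‖ * intervalMean p (‖x‖ ^ n)

theorem intervalMean_min_of_le {R s : ℝ} (hs : 0 ≤ s) (hR : s ≤ R) :
    intervalMean (fun t => p (min t R)) s = intervalMean p s := by
  unfold intervalMean
  refine intervalIntegral.integral_congr fun t ht => ?_
  rw [uIcc_of_le zero_le_one] at ht
  simp only
  rw [min_eq_left]
  exact (mul_le_of_le_one_right hs ht.2).trans hR

/-- The radial field with divergence truncated at height `p R` can be used as a test field for the
density `radialDensity n p`, even though it is not compactly supported, and so can its
perturbations. -/
theorem setIntegral_add_le_of_norm_add_le (hn : n ≠ 0) (hp : Continuous p) (hpm : Monotone p)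
    (hp0 : ∀ s, 0 ≤ p s) {E : Set (EuclideanSpace ℝ (Fin n))} (hEt : volume E ≠ ⊤) {P R : ℝ}
    (hP : ∀ φ ∈ testFields (radialDensity n p), ∫ x in E, vecDiv φ x ≤ P)
    {w : EuclideanSpace ℝ (Fin n) → EuclideanSpace ℝ (Fin n)} (hw : ContDiff ℝ 1 w)
    (hwc : HasCompactSupport w)
    (hwb : ∀ x, ‖radialField n (fun t => p (min t R)) x + w x‖ ≤ radialDensity n p x) :
    (∫ x in E, n * p (min (‖x‖ ^ n) R)) + ∫ x in E, vecDiv w x ≤ P := by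
  set q : ℝ → ℝ := fun t => p (min t R) with hq
  have hqc : Continuous q := by fun_prop
  have hq0 (s) : 0 ≤ q s := hp0 _
  have hqR (s) : q s ≤ p R := hpm (min_le_right _ _)
  have hqp (s) : q s ≤ p s := hpm (min_le_left _ _)
  have hΦ := contDiff_radialField hn hqc
  have hΦn (x) := norm_radialField (n := n) hq0 x
  have hlim := tendsto_setIntegral_vecDiv_cutoff hEt hΦ (M := p R) (M' := n * p R) (fun x => by
    rw [hΦn, mul_comm]
    gcongr
    exact intervalMean_le hqc hqR _) (fun x => by
    rw [vecDiv_radialField hn hqc, abs_of_nonneg (mul_nonneg (by positivity) (hq0 _))]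
    gcongr
    exact hqR _)
  simp only [vecDiv_radialField hn hqc] at hlim
  refine le_of_tendsto (hlim.add_const _) ?_
  obtain ⟨r, hr⟩ := hwc.isCompact.isBounded.subset_closedBall 0
  obtain ⟨N, hN⟩ := exists_nat_gt r
  filter_upwards [eventually_ge_atTop N] with k hk
  have hk' : (N : ℝ) ≤ k := by exact_mod_cast hk
  have hχΦ : ContDiff ℝ 1 fun y => cutoff k y • radialField n q y :=
    (contDiff_cutoff k (m := 1)).smul hΦ
  have hχΦc : HasCompactSupport fun y => cutoff k y • radialField n q y :=
    (hasCompactSupport_cutoff k).smul_right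
  have hmem : (fun y => cutoff k y • radialField n q y + w y) ∈ testFields (radialDensity n p) := by
    refine ⟨hχΦ.add hw, hχΦc.add hwc, fun x => ?_⟩
    by_cases hx : w x = 0
    · simp only [hx, add_zero, norm_smul, Real.norm_of_nonneg (cutoff_nonneg k x), hΦn]
      refine (mul_le_of_le_one_left (mul_nonneg (norm_nonneg _) (intervalMean_nonneg hq0 _))
        (cutoff_le_one k x)).trans ?_
      unfold radialDensity
      gcongr
      exact intervalMean_mono hqc hp hqp _
    · have : x ∈ Metric.closedBall 0 r := hr (subset_tsupport _ hx)
      have : ‖x‖ < k + 1 := by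
        have : ‖x‖ ≤ r := by simpa using this
        linarith
      simp only [cutoff_eq_one this, one_smul]
      exact hwb x
  have := hP _ hmem
  simp only [fun x => vecDiv_add (hχΦ.differentiable one_ne_zero x) (hw.differentiable one_ne_zero x)]
    at this
  rwa [integral_add (integrable_vecDiv hχΦ hχΦc).integrableOn
    (integrable_vecDiv hw hwc).integrableOn] at this

theorem setIntegral_ball_truncated (hn : n ≠ 0) (hp : Continuous p) {ρ R : ℝ} (hρ : 0 < ρ)
    (hR : ρ ^ n ≤ R) :
    ∫ x in Metric.ball (0 : EuclideanSpace ℝ (Fin n)) ρ, n * p (min (‖x‖ ^ n) R) =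
      n * (ρ * intervalMean p (ρ ^ n)) * ρ ^ (n - 1) *
        volume.real (Metric.ball (0 : EuclideanSpace ℝ (Fin n)) 1) := by
  rw [← setIntegral_ball_radial hn hp hρ]
  refine setIntegral_congr_fun Metric.isOpen_ball.measurableSet fun x hx => ?_
  have : ‖x‖ ≤ ρ := by simpa using (Metric.mem_ball.1 hx).le
  rw [min_eq_left ((by gcongr : ‖x‖ ^ n ≤ ρ ^ n).trans hR)]

/-- Among sets of given volume, the centred ball has the least flux of the calibrating field. -/
theorem setIntegral_ball_truncated_le (hpm : Monotone p)
    (hp0 : ∀ s, 0 ≤ p s) {E : Set (EuclideanSpace ℝ (Fin n))} (hE : MeasurableSet E) {ρ R : ℝ}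
    (hV : volume E = volume (Metric.ball (0 : EuclideanSpace ℝ (Fin n)) ρ)) :
    ∫ x in Metric.ball (0 : EuclideanSpace ℝ (Fin n)) ρ, n * p (min (‖x‖ ^ n) R) ≤
      ∫ x in E, n * p (min (‖x‖ ^ n) R) := by
  have := setIntegral_ball_le_setIntegral hE hV (g := fun r => n * p (min ((max r 0) ^ n) R))
    (fun r s hrs => by
      have : p (min ((max r 0) ^ n) R) ≤ p (min ((max s 0) ^ n) R) := hpm (by gcongr)
      simp only; gcongr) (M := n * p R) (fun s => by
      rw [abs_of_nonneg (mul_nonneg (by positivity) (hp0 _))]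
      gcongr
      exact hpm (min_le_right _ _))
  simpa only [max_eq_left (norm_nonneg _)] using this

end Calibration

section Optimal

variable {n : ℕ} {p : ℝ → ℝ}

/-- The surface area of the centred ball is at most `a ρ` times the area of the sphere. -/
theorem weightedPerimeter_ball_le (hn : n ≠ 0) {a : ℝ → ℝ} (ha0 : ∀ s : ℝ, 0 ≤ s → 0 ≤ a s)
    (ha : MonotoneOn a (Ici 0)) {ρ : ℝ} (hρ : 0 < ρ) :
    weightedPerimeter (fun x : EuclideanSpace ℝ (Fin n) => a ‖x‖) (Metric.ball 0 ρ) ≤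
      ENNReal.ofReal (n * a ρ * ρ ^ (n - 1) *
        volume.real (Metric.ball (0 : EuclideanSpace ℝ (Fin n)) 1)) :=
  iSup₂_le fun _ hφ => ENNReal.ofReal_le_ofReal <|
    setIntegral_ball_vecDiv_le hn hφ.1 hφ.2.1 (ha0 ρ hρ.le) hρ fun x hx =>
      (hφ.2.2 x).trans (ha (norm_nonneg x) hρ.le hx)

/-- The lower bound for the surface area, strengthened by a perturbation `w` of the calibrating
field. -/
theorem area_add_le_of_weightedPerimeter_le (hn : n ≠ 0) (hp : Continuous p) (hpm : Monotone p)
    (hp0 : ∀ s, 0 ≤ p s) {c : ℝ} (hc : 0 ≤ c) {E : Set (EuclideanSpace ℝ (Fin n))}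
    (hE : MeasurableSet E) {ρ : ℝ} (hρ : 0 < ρ)
    (hV : volume E = volume (Metric.ball (0 : EuclideanSpace ℝ (Fin n)) ρ)) {P R : ℝ} (hP0 : 0 ≤ P)
    (hP : weightedPerimeter (fun x => c + radialDensity n p x) E ≤ ENNReal.ofReal P)
    {w : EuclideanSpace ℝ (Fin n) → EuclideanSpace ℝ (Fin n)} (hw : ContDiff ℝ 1 w)
    (hwc : HasCompactSupport w)
    (hwb : ∀ x, ‖radialField n (fun t => p (min t R)) x + w x‖ ≤ radialDensity n p x) :
    c * (n * ρ ^ (n - 1) * volume.real (Metric.ball (0 : EuclideanSpace ℝ (Fin n)) 1)) +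
      (∫ x in E, n * p (min (‖x‖ ^ n) R)) + ∫ x in E, vecDiv w x ≤ P := by
  have := setIntegral_add_le_of_norm_add_le hn hp hpm hp0 (E := E)
    (by rw [hV]; exact measure_ball_lt_top.ne) (P := P - c * (n * ρ ^ (n - 1) *
      volume.real (Metric.ball (0 : EuclideanSpace ℝ (Fin n)) 1))) (fun φ hφ => by
      linarith [mul_sphere_area_add_le hn hc hE hρ hV hP0 hP hφ]) hw hwc hwb
  linarith

theorem norm_radialField_min_le (hp : Continuous p) (hpm : Monotone p)
    (hp0 : ∀ s, 0 ≤ p s) (R : ℝ) (x : EuclideanSpace ℝ (Fin n)) :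
    ‖radialField n (fun t => p (min t R)) x‖ ≤ radialDensity n p x := by
  rw [norm_radialField fun s => hp0 _]
  unfold radialDensity
  gcongr
  exact intervalMean_mono (by fun_prop) hp (fun s => hpm (min_le_left _ _)) _

/-- A set with the volume of the centred ball has at least the surface area of the ball. -/
theorem ofReal_area_le_weightedPerimeter (hn : n ≠ 0) (hp : Continuous p) (hpm : Monotone p)
    (hp0 : ∀ s, 0 ≤ p s) {c : ℝ} (hc : 0 ≤ c) {E : Set (EuclideanSpace ℝ (Fin n))}
    (hE : MeasurableSet E) {ρ : ℝ} (hρ : 0 < ρ)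
    (hV : volume E = volume (Metric.ball (0 : EuclideanSpace ℝ (Fin n)) ρ)) :
    ENNReal.ofReal (n * (c + ρ * intervalMean p (ρ ^ n)) * ρ ^ (n - 1) *
        volume.real (Metric.ball (0 : EuclideanSpace ℝ (Fin n)) 1)) ≤
      weightedPerimeter (fun x => c + radialDensity n p x) E := by
  by_cases ht : weightedPerimeter (fun x => c + radialDensity n p x) E = ⊤
  · rw [ht]; exact le_top
  rw [← ENNReal.ofReal_toReal ht]
  apply ENNReal.ofReal_le_ofReal
  have h1 := area_add_le_of_weightedPerimeter_le hn hp hpm hp0 hc hE hρ hV (R := ρ ^ n)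
    ENNReal.toReal_nonneg (ENNReal.ofReal_toReal ht).ge (w := 0) contDiff_const
    HasCompactSupport.zero (fun x => by simpa using norm_radialField_min_le hp hpm hp0 _ x)
  have h2 := setIntegral_ball_truncated_le hpm hp0 hE hV (R := ρ ^ n)
  rw [setIntegral_ball_truncated hn hp hρ le_rfl] at h2
  have h3 : ∫ x in E, vecDiv (0 : EuclideanSpace ℝ (Fin n) → EuclideanSpace ℝ (Fin n)) x = 0 := by
    simp [vecDiv]
  rw [h3] at h1
  nlinarith

/-- The flux of an admissible perturbation of the calibrating field out of an optimal set is at most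
the flux of the calibrating field out of the ball. -/
theorem setIntegral_add_vecDiv_le_ball (hn : n ≠ 0) (hp : Continuous p) (hpm : Monotone p)
    (hp0 : ∀ s, 0 ≤ p s) {c : ℝ} (hc : 0 ≤ c) {E : Set (EuclideanSpace ℝ (Fin n))}
    (hE : MeasurableSet E) {ρ : ℝ} (hρ : 0 < ρ)
    (hV : volume E = volume (Metric.ball (0 : EuclideanSpace ℝ (Fin n)) ρ))
    (hP : weightedPerimeter (fun x => c + radialDensity n p x) E ≤
      ENNReal.ofReal (n * (c + ρ * intervalMean p (ρ ^ n)) * ρ ^ (n - 1) *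
        volume.real (Metric.ball (0 : EuclideanSpace ℝ (Fin n)) 1))) {R : ℝ} (hR : ρ ^ n ≤ R)
    {w : EuclideanSpace ℝ (Fin n) → EuclideanSpace ℝ (Fin n)} (hw : ContDiff ℝ 1 w)
    (hwc : HasCompactSupport w)
    (hwb : ∀ x, ‖radialField n (fun t => p (min t R)) x + w x‖ ≤ radialDensity n p x) :
    (∫ x in E, n * p (min (‖x‖ ^ n) R)) + ∫ x in E, vecDiv w x ≤
      ∫ x in Metric.ball (0 : EuclideanSpace ℝ (Fin n)) ρ, n * p (min (‖x‖ ^ n) R) := by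
  have h0 := intervalMean_nonneg hp0 (ρ ^ n)
  have h1 := area_add_le_of_weightedPerimeter_le hn hp hpm hp0 hc hE hρ hV (R := R)
    (by positivity) hP hw hwc hwb
  rw [setIntegral_ball_truncated hn hp hρ hR]
  linarith

end Optimal

/-! ### Rigidity of the calibration -/

section Rigidity

variable {n : ℕ} {p : ℝ → ℝ}

/-- If adding any admissible perturbation to the calibrating fields does not increase the flux, then
the distributional derivative of the indicator function of `E` is nonnegative in inward directions
wherever the density is positive: a small inward perturbation shortens the calibrating field, hence
is admissible. -/
theorem setIntegral_vecDiv_smul_const_nonpos (hp : Continuous p) (hpm : Monotone p)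
    (hp0 : ∀ s, 0 ≤ p s) {E : Set (EuclideanSpace ℝ (Fin n))} {R₀ : ℝ}
    (hopt : ∀ R, R₀ ≤ R → ∀ w : EuclideanSpace ℝ (Fin n) → EuclideanSpace ℝ (Fin n),
      ContDiff ℝ 1 w → HasCompactSupport w →
      (∀ x, ‖radialField n (fun t => p (min t R)) x + w x‖ ≤ radialDensity n p x) →
      ∫ x in E, vecDiv w x ≤ 0)
    {g : EuclideanSpace ℝ (Fin n) → ℝ} (hg : ContDiff ℝ 1 g) (hgc : HasCompactSupport g)
    (hg0 : ∀ x, 0 ≤ g x) {v : EuclideanSpace ℝ (Fin n)}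
    (hpos : ∀ x ∈ tsupport g, 0 < intervalMean p (‖x‖ ^ n))
    (hin : ∀ x ∈ tsupport g, inner ℝ x v < 0) :
    ∫ x in E, vecDiv (fun y => g y • v) x ≤ 0 := by
  rcases (tsupport g).eq_empty_or_nonempty with hemp | hne
  · have : g = 0 := tsupport_eq_empty_iff.1 hemp
    simp [this, vecDiv]
  have hK : IsCompact (tsupport g) := hgc
  have hm := continuous_intervalMean hp
  obtain ⟨r, hr⟩ := hK.isBounded.subset_closedBall 0
  obtain ⟨G, hG⟩ := hgc.exists_bound_of_continuous hg.continuous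
  obtain ⟨x₀, hx₀, hmin⟩ := hK.exists_isMinOn hne
    (f := fun x => intervalMean p (‖x‖ ^ n) * (-inner ℝ x v)) (by fun_prop)
  set δ := intervalMean p (‖x₀‖ ^ n) * (-inner ℝ x₀ v)
  have hδ : 0 < δ := mul_pos (hpos _ hx₀) (neg_pos.2 (hin _ hx₀))
  set R := max R₀ (r ^ n)
  have hG0 : 0 ≤ G := (norm_nonneg _).trans (hG x₀)
  -- `‖Φ + ε g v‖² = ‖Φ‖² + ε g (2 ⟪Φ, v⟫ + ε g ‖v‖²)` is at most `‖Φ‖²` for this `ε`, since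
  -- `⟪Φ, v⟫ ≤ -δ` on the support of `g`
  set ε := δ / (G * ‖v‖ ^ 2 + 1)
  have hε : 0 < ε := by positivity
  have hεle : ε * (G * ‖v‖ ^ 2) ≤ 2 * δ := by
    have : ε * (G * ‖v‖ ^ 2 + 1) = δ := by simp only [ε]; field_simp
    nlinarith
  have hsm : ContDiff ℝ 1 fun y => g y • v := hg.smul contDiff_const
  have hw := hopt R (le_max_left _ _) (fun y => ε • (g y • v)) (hsm.const_smul ε)
    (hgc.smul_right.smul_left (f := fun _ => ε)) (fun x => by
      refine le_trans ?_ (norm_radialField_min_le hp hpm hp0 R x)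
      by_cases hx : x ∈ tsupport g
      · have hxr : ‖x‖ ≤ r := by simpa using hr hx
        have hxR : ‖x‖ ^ n ≤ R := (by gcongr : ‖x‖ ^ n ≤ r ^ n).trans (le_max_right _ _)
        have hδx : δ ≤ intervalMean p (‖x‖ ^ n) * (-inner ℝ x v) := hmin hx
        have hgG : g x ≤ G := (le_abs_self _).trans (hG x)
        have hΦ : radialField n (fun t => p (min t R)) x = intervalMean p (‖x‖ ^ n) • x := by
          rw [radialField, intervalMean_min_of_le (by positivity) hxR]
        rw [hΦ, ← sq_le_sq₀ (norm_nonneg _) (norm_nonneg _), norm_add_sq_real]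
        have hi : inner ℝ (intervalMean p (‖x‖ ^ n) • x) (ε • g x • v) =
            ε * g x * (intervalMean p (‖x‖ ^ n) * inner ℝ x v) := by
          simp only [inner_smul_left, inner_smul_right]
          simp; ring
        have hn : ‖ε • g x • v‖ ^ 2 = ε * g x * (ε * (g x * ‖v‖ ^ 2)) := by
          rw [norm_smul, norm_smul, Real.norm_of_nonneg hε.le, Real.norm_of_nonneg (hg0 x)]; ring
        rw [hi, hn]
        have h1 : 0 ≤ ε * g x := mul_nonneg hε.le (hg0 x)
        have h2 : ε * (g x * ‖v‖ ^ 2) ≤ 2 * δ := le_trans (by gcongr) hεle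
        nlinarith
      · simp [image_eq_zero_of_notMem_tsupport hx])
  have hd (x) : vecDiv (fun y => ε • (g y • v)) x = ε * vecDiv (fun y => g y • v) x :=
    vecDiv_const_smul ε (hsm.differentiable one_ne_zero x)
  simp only [hd] at hw
  rw [integral_const_mul] at hw
  exact nonpos_of_mul_nonpos_right hw hε

theorem fderiv_mollify_eq_vecDiv {η : EuclideanSpace ℝ (Fin n) → ℝ}
    {E : Set (EuclideanSpace ℝ (Fin n))} (hE : MeasurableSet E) (hη : ContDiff ℝ 1 η)
    (hc : HasCompactSupport η) (x v : EuclideanSpace ℝ (Fin n)) :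
    fderiv ℝ (mollify η E) x v = ∫ t in E, vecDiv (fun y => η (x - y) • (-v)) t := by
  rw [fderiv_mollify_apply hE hη hc]
  congr 1; ext t
  have h : HasFDerivAt (fun y => η (x - y)) (-(fderiv ℝ η (x - t))) t := by
    have h1 := (hη.differentiable one_ne_zero (x - t)).hasFDerivAt.comp t
      ((hasFDerivAt_id t).const_sub x)
    refine h1.congr_fderiv ?_
    ext; simp
  rw [vecDiv_smul h.differentiableAt (differentiableAt_const _), h.fderiv]
  simp [vecDiv]

/-- Along a curve with outward velocity, the mollified indicator functions are eventually
nonincreasing. -/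
theorem eventually_mollify_le_of_curve {E : Set (EuclideanSpace ℝ (Fin n))} (hE : MeasurableSet E)
    {D : Set (EuclideanSpace ℝ (Fin n))} (hD : IsOpen D)
    (hdir : ∀ (g : EuclideanSpace ℝ (Fin n) → ℝ) (v : EuclideanSpace ℝ (Fin n)), ContDiff ℝ 1 g →
      HasCompactSupport g → (∀ x, 0 ≤ g x) → tsupport g ⊆ D → (∀ x ∈ tsupport g, inner ℝ x v < 0) →
      ∫ x in E, vecDiv (fun y => g y • v) x ≤ 0)
    {γ γ' : ℝ → EuclideanSpace ℝ (Fin n)} (hγ : ∀ t ∈ Icc (0 : ℝ) 1, HasDerivAt γ (γ' t) t)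
    (hγ' : ContinuousOn γ' (Icc 0 1)) (hout : ∀ t ∈ Icc (0 : ℝ) 1, 0 < inner ℝ (γ t) (γ' t))
    (hγD : ∀ t ∈ Icc (0 : ℝ) 1, γ t ∈ D) :
    ∀ᶠ k in atTop, mollify (mollifier n k) E (γ 1) ≤ mollify (mollifier n k) E (γ 0) := by
  have hγc : ContinuousOn γ (Icc 0 1) := fun t ht => (hγ t ht).continuousAt.continuousWithinAt
  let K := (fun t => (γ t, γ' t)) '' Icc (0 : ℝ) 1
  let U : Set (EuclideanSpace ℝ (Fin n) × EuclideanSpace ℝ (Fin n)) :=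
    {q | 0 < inner ℝ q.1 q.2} ∩ Prod.fst ⁻¹' D
  have hK : IsCompact K := isCompact_Icc.image_of_continuousOn (hγc.prodMk hγ')
  have hU : IsOpen U := (isOpen_lt continuous_const (by fun_prop)).inter (hD.preimage continuous_fst)
  have hKU : K ⊆ U := by
    rintro _ ⟨t, ht, rfl⟩
    exact ⟨hout t ht, hγD t ht⟩
  obtain ⟨δ, hδ, hsub⟩ := hK.exists_cthickening_subset_open hU hKU
  have hlim : Tendsto (fun k : ℕ => 2 / ((k : ℝ) + 1)) atTop (𝓝 0) := by
    have := (tendsto_one_div_add_atTop_nhds_zero_nat (𝕜 := ℝ)).const_mul 2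
    simpa [div_eq_mul_inv] using this
  filter_upwards [hlim.eventually (ge_mem_nhds hδ)] with k hk
  have hη := contDiff_mollifier (n := n) k
  have hηc := hasCompactSupport_mollifier (n := n) k
  have hf := contDiff_mollify hE hη hηc
  have hder (t) (ht : t ∈ Icc (0 : ℝ) 1) : HasDerivAt (fun t => mollify (mollifier n k) E (γ t))
      (fderiv ℝ (mollify (mollifier n k) E) (γ t) (γ' t)) t :=
    (hf.differentiable one_ne_zero (γ t)).hasFDerivAt.comp_hasDerivAt t (hγ t ht)
  have hanti : AntitoneOn (fun t => mollify (mollifier n k) E (γ t)) (Icc 0 1) := by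
    refine antitoneOn_of_deriv_nonpos (convex_Icc 0 1)
      (fun t ht => (hder t ht).continuousAt.continuousWithinAt)
      (fun t ht => (hder t (interior_subset ht)).differentiableAt.differentiableWithinAt)
      fun t ht => ?_
    have ht' := interior_subset ht
    rw [(hder t ht').deriv, fderiv_mollify_eq_vecDiv hE hη hηc]
    have hts (z) (hz : z ∈ tsupport fun y => mollifier n k (γ t - y)) : (z, γ' t) ∈ U := by
      refine hsub (Metric.mem_cthickening_of_dist_le _ (γ t, γ' t) δ _ ⟨t, ht', rfl⟩ ?_)
      have h1 : γ t - z ∈ tsupport (mollifier n k) :=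
        tsupport_comp_subset_preimage (mollifier n k) (f := fun y => γ t - y) (by fun_prop) hz
      rw [tsupport_mollifier, mem_closedBall_zero_iff] at h1
      rw [Prod.dist_eq, dist_self, dist_eq_norm, norm_sub_rev]
      exact max_le (h1.trans hk) hδ.le
    refine hdir _ _ (hη.comp (by fun_prop)) (hηc.comp_homeomorph (Homeomorph.subLeft (γ t)))
      (fun _ => mollifier_nonneg k _) (fun z hz => (hts z hz).2) fun z hz => ?_
    rw [inner_neg_right]
    exact neg_neg_of_pos (hts z hz).1
  exact hanti (left_mem_Icc.2 zero_le_one) (right_mem_Icc.2 zero_le_one) zero_le_one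

/-- Two points with different norms that do not lie on a common line through the origin are joined
by a curve along which the norm increases. -/
theorem exists_curve_of_norm_lt {x y : EuclideanSpace ℝ (Fin n)} (hx : x ≠ 0) (hxy : ‖x‖ < ‖y‖)
    (hspan : x ∉ Submodule.span ℝ {y}) :
    ∃ γ γ' : ℝ → EuclideanSpace ℝ (Fin n), γ 0 = x ∧ γ 1 = y ∧
      (∀ t ∈ Icc (0 : ℝ) 1, HasDerivAt γ (γ' t) t) ∧ ContinuousOn γ' (Icc 0 1) ∧
      (∀ t ∈ Icc (0 : ℝ) 1, 0 < inner ℝ (γ t) (γ' t)) ∧ ∀ t ∈ Icc (0 : ℝ) 1, ‖x‖ ≤ ‖γ t‖ := by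
  have hx' : 0 < ‖x‖ := norm_pos_iff.2 hx
  have hy' : 0 < ‖y‖ := hx'.trans hxy
  -- the direction moves along a segment between vectors of equal length, the norm grows linearly
  let c : ℝ → EuclideanSpace ℝ (Fin n) := fun t => ((1 - t) * ‖y‖) • x + (t * ‖x‖) • y
  let r : ℝ → ℝ := fun t => (1 - t) * ‖x‖ + t * ‖y‖
  have hc0 (t : ℝ) (ht : t ∈ Icc (0 : ℝ) 1) : c t ≠ 0 := by
    intro h
    rcases eq_or_ne t 1 with rfl | ht1
    · simp only [c, sub_self, zero_mul, zero_smul, zero_add, one_mul, smul_eq_zero] at h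
      rcases h with h | h
      · exact hx'.ne' h
      · rw [h, norm_zero] at hy'; exact lt_irrefl _ hy'
    · apply hspan
      rw [Submodule.mem_span_singleton]
      refine ⟨-((1 - t) * ‖y‖)⁻¹ * (t * ‖x‖), ?_⟩
      have hne : (1 - t) * ‖y‖ ≠ 0 := mul_ne_zero (sub_ne_zero.2 (Ne.symm ht1)) hy'.ne'
      rw [mul_smul, eq_neg_of_add_eq_zero_right h, smul_neg, neg_smul, neg_neg, smul_smul,
        inv_mul_cancel₀ hne, one_smul]
  have hcd : ContDiff ℝ 1 c := by fun_prop
  have hrd : ContDiff ℝ 1 r := by fun_prop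
  let O : Set ℝ := {t | c t ≠ 0}
  have hO : IsOpen O := isOpen_ne_fun hcd.continuous continuous_const
  let γ : ℝ → EuclideanSpace ℝ (Fin n) := fun t => (r t / ‖c t‖) • c t
  have hγd : ContDiffOn ℝ 1 γ O := fun t ht =>
    (((hrd.contDiffAt.div (hcd.contDiffAt.norm ℝ ht) (norm_ne_zero_iff.2 ht)).smul
      hcd.contDiffAt)).contDiffWithinAt
  have hγder (t) (ht : t ∈ O) : HasDerivAt γ (deriv γ t) t :=
    ((hγd.differentiableOn one_ne_zero t ht).differentiableAt (hO.mem_nhds ht)).hasDerivAt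
  have hr0 (t) (ht : t ∈ Icc (0 : ℝ) 1) : ‖x‖ ≤ r t := by
    simp only [r]
    nlinarith [ht.1, ht.2]
  have hγn (t) (ht : t ∈ O) : ‖γ t‖ = |r t| := by
    simp only [γ]
    rw [norm_smul, norm_div, norm_norm, div_mul_cancel₀ _ (norm_ne_zero_iff.2 ht), Real.norm_eq_abs]
  refine ⟨γ, deriv γ, ?_, ?_, fun t ht => hγder t (hc0 t ht),
    (hγd.continuousOn_deriv_of_isOpen hO le_rfl).mono fun t ht => hc0 t ht, fun t ht => ?_,
    fun t ht => ?_⟩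
  · simp only [γ, r, c]
    simp only [sub_zero, one_mul, zero_mul, zero_smul, add_zero, norm_smul, norm_norm, smul_smul]
    have : ‖x‖ / (‖y‖ * ‖x‖) * ‖y‖ = 1 := by field_simp
    rw [this, one_smul]
  · simp only [γ, r, c]
    simp only [sub_self, one_mul, zero_mul, zero_smul, zero_add, norm_smul, norm_norm, smul_smul]
    have : ‖y‖ / (‖x‖ * ‖y‖) * ‖x‖ = 1 := by field_simp
    rw [this, one_smul]
  · have h1 := (hγder t (hc0 t ht)).norm_sq
    have h2 : HasDerivAt (fun t => r t ^ 2) (2 * r t * (‖y‖ - ‖x‖)) t := by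
      have hr : HasDerivAt r (‖y‖ - ‖x‖) t := by
        have := (((hasDerivAt_id t).const_sub 1).mul_const ‖x‖).add
          ((hasDerivAt_id t).mul_const ‖y‖)
        refine this.congr_deriv ?_
        ring
      refine (hr.pow 2).congr_deriv ?_
      ring
    have h3 : (fun t => ‖γ t‖ ^ 2) =ᶠ[𝓝 t] fun t => r t ^ 2 := by
      filter_upwards [hO.mem_nhds (hc0 t ht)] with s hs
      rw [hγn s hs, sq_abs]
    have h4 := h1.unique (h2.congr_of_eventuallyEq h3)
    have h5 := hr0 t ht
    have : 0 < 2 * r t * (‖y‖ - ‖x‖) := by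
      have : 0 < r t := by linarith
      have : 0 < ‖y‖ - ‖x‖ := by linarith
      positivity
    linarith
  · rw [hγn t (hc0 t ht)]
    exact (hr0 t ht).trans (le_abs_self _)

end Rigidity

/-! ### Uniqueness -/

section Uniqueness

variable {n : ℕ} {p : ℝ → ℝ}

theorem intervalMean_pos (hp : Continuous p) (hp0 : ∀ s, 0 ≤ p s) {s : ℝ} (hs : 0 < p s) :
    0 < intervalMean p s :=
  intervalIntegral.integral_pos zero_lt_one (by fun_prop) (fun _ _ => hp0 _)
    ⟨1, right_mem_Icc.2 zero_le_one, by simpa using hs⟩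

theorem intervalMean_mono_arg (hp : Continuous p) (hpm : Monotone p) {s t : ℝ} (hst : s ≤ t) :
    intervalMean p s ≤ intervalMean p t :=
  intervalIntegral.integral_mono_on zero_le_one (Continuous.intervalIntegrable (by fun_prop) _ _)
    (Continuous.intervalIntegrable (by fun_prop) _ _) fun u hu =>
      hpm (mul_le_mul_of_nonneg_right hst hu.1)

theorem ae_notMem_span_singleton (hn : 2 ≤ n) (y : EuclideanSpace ℝ (Fin n)) :
    ∀ᵐ x : EuclideanSpace ℝ (Fin n), x ∉ Submodule.span ℝ {y} := by
  refine measure_eq_zero_iff_ae_notMem.1 (Measure.addHaar_submodule volume _ fun h => ?_)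
  have h1 := finrank_span_le_card (R := ℝ) ({y} : Set (EuclideanSpace ℝ (Fin n)))
  rw [toFinset_singleton, Finset.card_singleton, h, finrank_top, finrank_euclideanSpace_fin] at h1
  omega

/-- If the indicator function of `E` has nonnegative distributional derivative in inward directions,
then `E` contains, together with a point `y` at which the mollifications tend to `1`, almost every
point nearer to the origin at which the density is positive. -/
theorem ae_mem_of_norm_lt (hn : 2 ≤ n) (hp : Continuous p) (hpm : Monotone p)
    {E : Set (EuclideanSpace ℝ (Fin n))} (hE : MeasurableSet E)
    (hdir : ∀ (g : EuclideanSpace ℝ (Fin n) → ℝ) (v : EuclideanSpace ℝ (Fin n)), ContDiff ℝ 1 g →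
      HasCompactSupport g → (∀ x, 0 ≤ g x) →
      tsupport g ⊆ {x | 0 < intervalMean p (‖x‖ ^ n)} → (∀ x ∈ tsupport g, inner ℝ x v < 0) →
      ∫ x in E, vecDiv (fun y => g y • v) x ≤ 0)
    {y : EuclideanSpace ℝ (Fin n)}
    (hy : Tendsto (fun k => mollify (mollifier n k) E y) atTop (𝓝 1)) :
    ∀ᵐ x : EuclideanSpace ℝ (Fin n), 0 < intervalMean p (‖x‖ ^ n) → ‖x‖ < ‖y‖ → x ∈ E := by
  have hm := continuous_intervalMean hp
  have h0 : ∀ᵐ x : EuclideanSpace ℝ (Fin n), x ∉ Submodule.span ℝ {y} :=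
    ae_notMem_span_singleton hn y
  filter_upwards [h0, ae_tendsto_mollify hE] with x hxs hxt hpos hxy
  have hx0 : x ≠ 0 := fun h => hxs (h ▸ Submodule.zero_mem _)
  obtain ⟨γ, γ', h0, h1, hγ, hγ', hout, hnorm⟩ := exists_curve_of_norm_lt hx0 hxy hxs
  have hev := eventually_mollify_le_of_curve hE (D := {x | 0 < intervalMean p (‖x‖ ^ n)})
    (isOpen_lt continuous_const (by fun_prop)) hdir hγ hγ' hout fun t ht =>
      hpos.trans_le (intervalMean_mono_arg hp hpm (by have := hnorm t ht; gcongr))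
  rw [h0, h1] at hev
  have hle := le_of_tendsto_of_tendsto hy hxt hev
  by_contra hxE
  rw [indicator_of_notMem hxE] at hle
  linarith

/-- An optimal set reaching beyond the ball would contain a larger ball, up to a set where the
divergence of the calibrating field vanishes, and then the flux of this field would be too large. -/
theorem ae_eq_ball_of_optimal (hn : 2 ≤ n) (hp : Continuous p) (hpm : Monotone p)
    (hp0 : ∀ s, 0 ≤ p s) {c : ℝ} (hc : 0 ≤ c) {E : Set (EuclideanSpace ℝ (Fin n))}
    (hE : MeasurableSet E) {ρ : ℝ} (hρ : 0 < ρ)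
    (hV : volume E = volume (Metric.ball (0 : EuclideanSpace ℝ (Fin n)) ρ))
    (hP : weightedPerimeter (fun x => c + radialDensity n p x) E ≤
      ENNReal.ofReal (n * (c + ρ * intervalMean p (ρ ^ n)) * ρ ^ (n - 1) *
        volume.real (Metric.ball (0 : EuclideanSpace ℝ (Fin n)) 1)))
    (hpos : ∀ r, ρ < r → 0 < intervalMean p (r ^ n)) :
    E =ᵐ[volume] Metric.ball (0 : EuclideanSpace ℝ (Fin n)) ρ := by
  have hn0 : n ≠ 0 := by omega
  have hEt : volume E ≠ ⊤ := by rw [hV]; exact measure_ball_lt_top.ne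
  have hflux {R : ℝ} (hR : ρ ^ n ≤ R) {w : EuclideanSpace ℝ (Fin n) → EuclideanSpace ℝ (Fin n)}
      (hw : ContDiff ℝ 1 w) (hwc : HasCompactSupport w) :=
    setIntegral_add_vecDiv_le_ball hn0 hp hpm hp0 hc hE hρ hV hP hR hw hwc
  have hdir (g : EuclideanSpace ℝ (Fin n) → ℝ) (v : EuclideanSpace ℝ (Fin n)) (hg : ContDiff ℝ 1 g)
      (hgc : HasCompactSupport g) (hg0 : ∀ x, 0 ≤ g x)
      (hgp : tsupport g ⊆ {x | 0 < intervalMean p (‖x‖ ^ n)})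
      (hgv : ∀ x ∈ tsupport g, inner ℝ x v < 0) :
      ∫ x in E, vecDiv (fun y => g y • v) x ≤ 0 := by
    refine setIntegral_vecDiv_smul_const_nonpos hp hpm hp0 (R₀ := ρ ^ n) (fun R hR w hw hwc hwb => ?_)
      hg hgc hg0 hgp hgv
    linarith [hflux hR hw hwc hwb, setIntegral_ball_truncated_le hpm hp0 hE hV (R := R)]
  have hsub : E ≤ᵐ[volume] Metric.closedBall (0 : EuclideanSpace ℝ (Fin n)) ρ := by
    by_contra hnot
    have hfreq : ∃ᶠ y in ae volume, y ∈ E ∧ y ∉ Metric.closedBall (0 : EuclideanSpace ℝ (Fin n)) ρ := by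
      intro h
      apply hnot
      filter_upwards [h] with y hy hyE
      by_contra hyB
      exact hy ⟨hyE, hyB⟩
    obtain ⟨y, ⟨hyE, hyB⟩, hyt⟩ := (hfreq.and_eventually (ae_tendsto_mollify hE)).exists
    rw [indicator_of_mem hyE] at hyt
    have hyρ : ρ < ‖y‖ := by simpa using hyB
    have hy0 : 0 < ‖y‖ := hρ.trans hyρ
    have hall := ae_mem_of_norm_lt hn hp hpm hE hdir hyt
    set T := Metric.ball (0 : EuclideanSpace ℝ (Fin n)) ‖y‖ with hT
    have hTm : MeasurableSet T := Metric.isOpen_ball.measurableSet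
    have hR : ρ ^ n ≤ ‖y‖ ^ n := by gcongr
    have hpow : ρ ^ n < ‖y‖ ^ n := pow_lt_pow_left₀ hyρ hρ.le hn0
    let G : EuclideanSpace ℝ (Fin n) → ℝ := fun x => n * p (min (‖x‖ ^ n) (‖y‖ ^ n))
    have hG0 (x) : 0 ≤ G x := mul_nonneg (by positivity) (hp0 _)
    have hGi (S : Set (EuclideanSpace ℝ (Fin n))) (hS : volume S ≠ ⊤) : IntegrableOn G S :=
      Measure.integrableOn_of_bounded (M := n * p (‖y‖ ^ n)) hS
        (Continuous.aestronglyMeasurable (by fun_prop)) (.of_forall fun x => by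
          rw [Real.norm_of_nonneg (hG0 x)]
          simp only [G]
          gcongr
          exact hpm (min_le_right _ _))
    have h1 := hflux hR (w := 0) contDiff_const HasCompactSupport.zero fun x => by
      simpa using norm_radialField_min_le hp hpm hp0 _ x
    have h2 : ∫ x in E, vecDiv (0 : EuclideanSpace ℝ (Fin n) → EuclideanSpace ℝ (Fin n)) x = 0 := by
      simp [vecDiv]
    rw [h2, add_zero, setIntegral_ball_truncated hn0 hp hρ hR] at h1
    have h3 : ∫ x in T, G x ≤ ∫ x in E, G x := by
      rw [← integral_inter_add_sdiff hE (hGi T measure_ball_lt_top.ne),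
        ← integral_inter_add_sdiff hTm (hGi E hEt), inter_comm E T]
      have e1 : ∫ x in T \ E, G x = 0 := by
        refine setIntegral_eq_zero_of_ae_eq_zero ?_
        filter_upwards [hall] with x hx hxT
        have hxy : ‖x‖ < ‖y‖ := by simpa [hT] using hxT.1
        have hnp : ¬ 0 < intervalMean p (‖x‖ ^ n) := fun h => hxT.2 (hx h hxy)
        have : p (‖x‖ ^ n) = 0 := by
          refine le_antisymm (not_lt.1 fun h => hnp (intervalMean_pos hp hp0 h)) (hp0 _)
        have hmin : ‖x‖ ^ n ≤ ‖y‖ ^ n := by gcongr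
        simp only [G]
        rw [min_eq_left hmin, this, mul_zero]
      have e2 : 0 ≤ ∫ x in E \ T, G x := integral_nonneg hG0
      linarith
    simp only [G] at h3
    rw [setIntegral_ball_truncated hn0 hp hy0 le_rfl] at h3
    have h4 := h3.trans h1
    have hκ : 0 < volume.real (Metric.ball (0 : EuclideanSpace ℝ (Fin n)) 1) :=
      ENNReal.toReal_pos (Metric.measure_ball_pos _ _ one_pos).ne' measure_ball_lt_top.ne
    have hpw (r : ℝ) : r ^ n = r ^ (n - 1) * r := by rw [← pow_succ, Nat.sub_add_cancel (by omega)]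
    have h5 : n * (ρ * intervalMean p (ρ ^ n)) * ρ ^ (n - 1) <
        n * (‖y‖ * intervalMean p (‖y‖ ^ n)) * ‖y‖ ^ (n - 1) := by
      have hmy := hpos _ hyρ
      have hmle := intervalMean_mono_arg hp hpm hpow.le
      have hnpos : (0 : ℝ) < n := by positivity
      calc n * (ρ * intervalMean p (ρ ^ n)) * ρ ^ (n - 1) = n * (ρ ^ n * intervalMean p (ρ ^ n)) := by
            generalize intervalMean p (ρ ^ n) = m
            rw [hpw ρ]; ring
        _ ≤ n * (ρ ^ n * intervalMean p (‖y‖ ^ n)) := by gcongr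
        _ < n * (‖y‖ ^ n * intervalMean p (‖y‖ ^ n)) := by gcongr
        _ = _ := by
            generalize intervalMean p (‖y‖ ^ n) = m
            rw [hpw ‖y‖]; ring
    exact absurd h4 (not_le.2 (by gcongr))
  have hball : Metric.closedBall (0 : EuclideanSpace ℝ (Fin n)) ρ =ᵐ[volume] Metric.ball 0 ρ :=
    (ae_eq_of_subset_of_measure_ge Metric.ball_subset_closedBall
      ((Measure.addHaar_closedBall _ _ hρ.le).trans (Measure.addHaar_ball_of_pos _ _ hρ).symm).le
      Metric.isOpen_ball.measurableSet.nullMeasurableSet measure_closedBall_lt_top.ne).symm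
  exact ae_eq_of_ae_subset_of_measure_ge (hsub.trans hball.le) hV.ge hE.nullMeasurableSet
    measure_ball_lt_top.ne

end Uniqueness

/-! ### The density as the length of a radial field -/

section Profile

/-- The convexity assumption in the form in which it is used: up to the additive constant `a 0`,
the density is the length of a radial field whose divergence is a nonnegative nondecreasing
function of the norm. -/
theorem exists_eq_add_mul_intervalMean {n : ℕ} (hn : 2 ≤ n) {a : ℝ → ℝ}
    (ha_mono : MonotoneOn a (Ici 0)) (ha_smooth : ContDiffOn ℝ 1 a (Ioi 0))
    (ha_convex : ConvexOn ℝ (Ici 0)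
      (fun s : ℝ => (a (s ^ (1 / (n : ℝ))) - a 0) * s ^ (1 - 1 / (n : ℝ)))) :
    ∃ p : ℝ → ℝ, Continuous p ∧ Monotone p ∧ (∀ s, 0 ≤ p s) ∧
      ∀ r, 0 ≤ r → a r = a 0 + r * intervalMean p (r ^ n) := by
  set h : ℝ → ℝ := fun s => (a (s ^ (1 / (n : ℝ))) - a 0) * s ^ (1 - 1 / (n : ℝ)) with hh
  have hn1 : (1 : ℝ) < n := by exact_mod_cast hn
  have hexp : 0 < 1 - 1 / (n : ℝ) := by
    rw [sub_pos, div_lt_one (by linarith)]; exact hn1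
  have h0 : h 0 = 0 := by simp only [hh]; rw [Real.zero_rpow hexp.ne', mul_zero]
  have hnonneg (s : ℝ) (hs : 0 ≤ s) : 0 ≤ h s := by
    have h1 : 0 ≤ s ^ (1 / (n : ℝ)) := Real.rpow_nonneg hs _
    exact mul_nonneg (sub_nonneg.2 (ha_mono self_mem_Ici h1 h1)) (Real.rpow_nonneg hs _)
  have hsm : ContDiffOn ℝ 1 h (Ioi 0) := by
    have hr (e : ℝ) : ContDiffOn ℝ 1 (fun s : ℝ => s ^ e) (Ioi 0) := fun s hs =>
      (Real.contDiffAt_rpow_const_of_ne (ne_of_gt hs)).contDiffWithinAt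
    exact ((ha_smooth.comp (hr _) fun s hs => Real.rpow_pos_of_pos hs _).sub contDiffOn_const).mul
      (hr _)
  have hdiff (s : ℝ) (hs : s ∈ Ioi (0 : ℝ)) : DifferentiableAt ℝ h s :=
    (hsm.differentiableOn one_ne_zero s hs).differentiableAt (isOpen_Ioi.mem_nhds hs)
  have hdc : ContinuousOn (deriv h) (Ioi 0) := hsm.continuousOn_deriv_of_isOpen isOpen_Ioi le_rfl
  have hdm : MonotoneOn (deriv h) (Ioi 0) :=
    (ha_convex.subset Ioi_subset_Ici_self (convex_Ioi 0)).monotoneOn_deriv hdiff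
  have hd0 (s : ℝ) (hs : 0 < s) : 0 ≤ deriv h s := by
    refine le_trans ?_ (ha_convex.slope_le_deriv self_mem_Ici (mem_Ici.2 hs.le) hs (hdiff s hs))
    rw [slope_def_field, h0]
    exact div_nonneg (by linarith [hnonneg s hs.le]) (by linarith)
  have hbdd : BddBelow (deriv h '' Ioi 0) := ⟨0, by rintro _ ⟨s, hs, rfl⟩; exact hd0 s hs⟩
  -- the derivative of `h` is extended to the left of `0` by its limit at `0`
  let p : ℝ → ℝ := fun s => if 0 < s then deriv h s else sInf (deriv h '' Ioi 0)
  have hppos (s : ℝ) (hs : 0 < s) : p s = deriv h s := if_pos hs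
  have hpneg (s : ℝ) (hs : s ≤ 0) : p s = sInf (deriv h '' Ioi 0) := if_neg (not_lt.2 hs)
  have hpm : Monotone p := by
    intro s t hst
    rcases lt_or_ge 0 s with hs | hs
    · rw [hppos s hs, hppos t (hs.trans_le hst)]
      exact hdm hs (hs.trans_le hst) hst
    · rw [hpneg s hs]
      rcases lt_or_ge 0 t with ht | ht
      · rw [hppos t ht]; exact csInf_le hbdd ⟨t, ht, rfl⟩
      · rw [hpneg t ht]
  have hp0 (s : ℝ) : 0 ≤ p s := by
    rcases lt_or_ge 0 s with hs | hs
    · rw [hppos s hs]; exact hd0 s hs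
    · rw [hpneg s hs]
      exact le_csInf (nonempty_Ioi.image _) (by rintro _ ⟨s, hs, rfl⟩; exact hd0 s hs)
  have hpc : Continuous p := by
    rw [continuous_iff_continuousAt]
    intro s
    rcases lt_trichotomy s 0 with hs | rfl | hs
    · refine continuousAt_const.congr (f := fun _ => sInf (deriv h '' Ioi 0)) ?_
      filter_upwards [gt_mem_nhds hs] with t ht using (hpneg t (le_of_lt ht)).symm
    · rw [continuousAt_iff_continuous_left'_right']
      constructor
      · rw [ContinuousWithinAt, hpneg 0 le_rfl]
        refine tendsto_const_nhds.congr' ?_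
        filter_upwards [self_mem_nhdsWithin] with t ht using (hpneg t (le_of_lt ht)).symm
      · have := hpm.tendsto_nhdsGT 0
        have himg : p '' Ioi 0 = deriv h '' Ioi 0 := image_congr fun t ht => hppos t ht
        rwa [himg, ← hpneg 0 le_rfl] at this
    · refine (hdc.continuousAt (isOpen_Ioi.mem_nhds hs)).congr ?_
      filter_upwards [lt_mem_nhds hs] with t ht using (hppos t ht).symm
  -- continuity at `0`, where `a` is not assumed continuous, follows from `0 ≤ h s ≤ s h 1`
  have hcont0 : ContinuousWithinAt h (Ici 0) 0 := by
    rw [ContinuousWithinAt, h0]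
    have hle : ∀ᶠ s in 𝓝[≥] (0 : ℝ), h s ≤ s * h 1 := by
      filter_upwards [Icc_mem_nhdsGE (zero_lt_one' ℝ)] with s hs
      have := ha_convex.2 self_mem_Ici (mem_Ici.2 zero_le_one) (sub_nonneg.2 hs.2) hs.1
        (by ring)
      simpa only [smul_eq_mul, mul_zero, mul_one, zero_add, ← hh, h0] using this
    refine tendsto_of_tendsto_of_tendsto_of_le_of_le' tendsto_const_nhds ?_
      (by filter_upwards [self_mem_nhdsWithin] with s hs using hnonneg s hs) hle
    have : Tendsto (fun s : ℝ => s * h 1) (𝓝 0) (𝓝 (0 * h 1)) :=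
      (continuous_id.mul continuous_const).tendsto 0
    rw [zero_mul] at this
    exact this.mono_left nhdsWithin_le_nhds
  have hint (s : ℝ) (hs : 0 ≤ s) : ∫ t in (0 : ℝ)..s, p t = h s := by
    have := intervalIntegral.integral_eq_sub_of_hasDerivAt_of_le hs (f := h) (f' := p)
      (fun t ht => by
        rcases ht.1.eq_or_lt with rfl | ht0
        · exact hcont0.mono Icc_subset_Ici_self
        · exact (hdiff t ht0).continuousAt.continuousWithinAt)
      (fun t ht => by rw [hppos t ht.1]; exact (hdiff t ht.1).hasDerivAt)
      (hpc.intervalIntegrable _ _)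
    rw [this, h0, sub_zero]
  refine ⟨p, hpc, hpm, hp0, fun r hr => ?_⟩
  rcases hr.eq_or_lt with rfl | hr0
  · simp
  have h1 : r ^ n * intervalMean p (r ^ n) = (a r - a 0) * (r ^ n / r) := by
    rw [mul_intervalMean, hint _ (by positivity)]
    simp only [hh]
    rw [Real.rpow_sub (by positivity), Real.rpow_one, one_div,
      Real.pow_rpow_inv_natCast hr (by omega)]
  have hrn : r ^ n ≠ 0 := by positivity
  have h2 : r ^ n * (r * intervalMean p (r ^ n)) = r ^ n * (a r - a 0) := by
    calc _ = r * (r ^ n * intervalMean p (r ^ n)) := by ring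
      _ = _ := by rw [h1]; field_simp
  linarith [mul_left_cancel₀ hrn h2]

end Profile
end

theorem mainTheorem5 (n : ℕ) (hn : 2 ≤ n) (a : ℝ → ℝ)
    (ha_nonneg : ∀ s : ℝ, 0 ≤ s → 0 ≤ a s)
    (ha_mono : MonotoneOn a (Ici 0))
    (ha_smooth : ContDiffOn ℝ ∞ a (Ioi 0))
    (ha_pos : ∀ s : ℝ, 0 < s → 0 < a s)
    (ha_convex : ConvexOn ℝ (Ici 0)
      (fun s : ℝ => (a (s ^ (1 / (n : ℝ))) - a 0) * s ^ (1 - 1 / (n : ℝ))))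
    (ρ : ℝ) (hρ : 0 < ρ) :
    IsIsoperimetric (fun x : EuclideanSpace ℝ (Fin n) => a ‖x‖) (Metric.ball 0 ρ) ∧
    ((∀ s : ℝ, ρ < s → a 0 < a s) →
      ∀ E : Set (EuclideanSpace ℝ (Fin n)),
        IsIsoperimetric (fun x : EuclideanSpace ℝ (Fin n) => a ‖x‖) E →
        volume E = volume (Metric.ball (0 : EuclideanSpace ℝ (Fin n)) ρ) →
        E =ᵐ[volume] Metric.ball (0 : EuclideanSpace ℝ (Fin n)) ρ) := by
  have hn0 : n ≠ 0 := by omega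
  obtain ⟨p, hp, hpm, hp0, hap⟩ := exists_eq_add_mul_intervalMean hn ha_mono
    (ha_smooth.of_le (by exact_mod_cast le_top)) ha_convex
  have hc : 0 ≤ a 0 := ha_nonneg 0 le_rfl
  have hdens : (fun x : EuclideanSpace ℝ (Fin n) => a ‖x‖) = fun x => a 0 + radialDensity n p x :=
    funext fun x => hap _ (norm_nonneg x)
  have hball := weightedPerimeter_ball_le hn0 ha_nonneg ha_mono hρ
  rw [hap ρ hρ.le] at hball
  refine ⟨⟨Metric.isOpen_ball.measurableSet, fun F hF hFV => hball.trans ?_⟩, fun hgt E hE hEV => ?_⟩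
  · rw [hdens]
    exact ofReal_area_le_weightedPerimeter hn0 hp hpm hp0 hc hF hρ hFV
  · have hopt := (hE.2 _ Metric.isOpen_ball.measurableSet hEV.symm).trans hball
    rw [hdens] at hopt
    refine ae_eq_ball_of_optimal hn hp hpm hp0 hc hE.1 hρ hEV hopt fun r hr => ?_
    have h1 := hgt r hr
    rw [hap r (hρ.trans hr).le] at h1
    exact pos_of_mul_pos_right (by linarith) (hρ.trans hr).le
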